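/- Let $K=2$ and $N\in\{2,3\}$. Consider the two-user device-to-device private caching system with a trusted server. The library consists of $N$ files $F_1,\dots,F_N$ of $B$ independent uniform bits each. The demand vector $\mathbf D=(D_1,D_2)\in\{1,\dots,N\}^2$ has a fixed law under which every demand vector has positive probability. User $k$ has the cache $Z_k=(\mathcal M(C_k),C_k)$, where the metadata $\mathcal M(C_k)$ is chosen, possibly at random, without knowledge of the demands, and the content $C_k$ is a function of the library and of $\mathcal M(C_k)$. From the demands and the metadata of the caches (and randomness of its own) the server, which has no access to the library, sends metadata $\mathcal M(P_k)$ to user $k$, describing how a payload $P_k$ is composed from the library. User $k$ then broadcasts $X_k=(\mathcal M(P_k),P_k)$. The library, the demands and the randomness of the placement and of the server are independent. Write $\mathbf X=(X_1,X_2)$. The load $R$ is achievable at cache size $M$ if there are $\epsilon_B\ge 0$ with $\epsilon_B\to 0$ such that for every sufficiently large $B$ some scheme satisfies, for $k=1,2$ (entropies in bits), $$H(Z_k)\le B(M+\epsilon_B),\quad H(X_k\mid \mathcal M(P_k),Z_k)=0,\quad H(F_{D_k}\mid \mathbf X,Z_k,D_k)\le B\epsilon_B,\quad I(\mathbf D;\mathbf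 X,Z_k\mid D_k)=0,$$ and $H(X_1)+H(X_2)\le B(R+\epsilon_B)$. The placement is uncoded if each user directly copies some of the bits of the files into its cache; $R^\star_{\mathrm u}(M)$ denotes the minimum load achievable with uncoded placement. Scheme B consists of the following schemes. For $t\in\{0,\dots,N-1\}$, each file is divided into two halves, one for each user, and each half into $\binom{N-1}{t}+\binom{N-2}{t-1}$ equal subfiles (with $\binom{N-2}{-1}=0$), which are permuted uniformly at random, independently for all halves. Each user caches its own half of each file and the first $\binom{N-2}{t-1}$ permuted subfiles of the other half. For each set $S$ of $t+1$ files, each user sends the sum modulo $2$ of one subfile of its own half of each file $i\in S$. No subfile is used twice, and, when the other user demands file $d$, the subfile of file $i$ is one that the other user caches if and only if $d\in S$ and $i\ne d$. Moreover, Scheme B includes the trivial scheme in which both users cache the whole library and nothing is sent, and memory-sharing between all these schemes. Let $R_{\mathrm B}(M)$ be the lower convex envelope of the points $(N,0)$ and $$\left(\frac N2+\frac{Nt}{2(N+t-1)},\ \frac{N(N-1)}{(t+1)(N+t-1)}\right),\qquad t\in\{0,1,\dots,N-1\}.$$ Then, for every memory size $M\in[N/2,N]$, Scheme B is exactly optimal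 under uncoded cache placement: the minimum load achievable at cache size $M$ by Scheme B is $R_{\mathrm B}(M)$, and it equals the minimum load achievable with uncoded placement, that is, $R^\star_{\mathrm u}(M)=R_{\mathrm B}(M)$. -/

import Mathlib

open Filter Topology

noncomputable section

/-! ## Shannon entropies (in bits) of finite-valued random variables -/

/-- Shannon entropy `H(X)`, in bits, of a random variable with values in a finite type. -/
def entropy {Ω α : Type} [Fintype α] (P : PMF Ω) (X : Ω → α) : ℝ :=
  (∑ x, Real.negMulLog ((P.map X) x).toReal) / Real.log 2

/-- Conditional entropy `H(X | Y) = H(X, Y) - H(Y)`. -/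
def condEntropy {Ω α β : Type} [Fintype α] [Fintype β] (P : PMF Ω)
    (X : Ω → α) (Y : Ω → β) : ℝ :=
  entropy P (fun ω => (X ω, Y ω)) - entropy P Y

/-- Conditional mutual information `I(X; Y | Z) = H(X | Z) - H(X | Y, Z)`. -/
def condMutualInfo {Ω α β γ : Type} [Fintype α] [Fintype β] [Fintype γ] (P : PMF Ω)
    (X : Ω → α) (Y : Ω → β) (Z : Ω → γ) : ℝ :=
  condEntropy P X Z - condEntropy P X (fun ω => (Y ω, Z ω))

/-! ## The device-to-device private caching system with a trusted server -/

/-- A library of `N` files of `B` bits each. -/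
abbrev Library (N B : ℕ) : Type := Fin N → Fin B → ZMod 2

/-- The demands of the `K` users. -/
abbrev Demands (K N : ℕ) : Type := Fin K → Fin N

/-- A caching scheme for `K` users and `N` files of `B` bits. The whole randomness of the
placement and of the trusted server is in the `Seed`, which is independent of the library and of
the demands. The metadata and the contents of the users take their values in common finite
alphabets. -/
structure CachingScheme (K N B : ℕ) : Type 1 where
  /-- randomness of the placement and of the server -/
  Seed : Type
  /-- alphabet of the metadata of the cached contents -/
  CacheMeta : Type
  /-- alphabet of the cached contents -/
  Content : Type
  /-- alphabet of the metadata of the transmitted packets -/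
  TxMeta : Type
  /-- alphabet of the transmitted packets -/
  Payload : Type
  [fintypeSeed : Fintype Seed]
  [fintypeCacheMeta : Fintype CacheMeta]
  [fintypeContent : Fintype Content]
  [fintypeTxMeta : Fintype TxMeta]
  [fintypePayload : Fintype Payload]
  /-- the law of the seed -/
  seedLaw : PMF Seed
  /-- the metadata of the cache of each user, chosen without knowledge of the demands -/
  cacheMeta : Seed → Fin K → CacheMeta
  /-- the cached content of each user, a function of its metadata and of the library -/
  content : Fin K → CacheMeta → Library N B → Content
  /-- the metadata that the server, which has no access to the library, sends to each user -/
  txMeta : Seed → Demands K N → Fin K → TxMeta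
  /-- the packets of each user, whose composition is described by the metadata from the server -/
  payload : Fin K → TxMeta → Library N B → Payload

namespace CachingScheme

attribute [instance] fintypeSeed fintypeCacheMeta fintypeContent fintypeTxMeta fintypePayload

variable {K N B : ℕ} (s : CachingScheme K N B)

/-- The sample space: library, demands and seed. -/
abbrev Sample : Type := Library N B × Demands K N × s.Seed

/-- The joint law: the bits of the library are independent and uniform, the demands have the given
law, and library, demands and seed are independent. -/
def law (demandLaw : PMF (Demands K N)) : PMF s.Sample :=
  (PMF.uniformOfFintype (Library N B)).bind fun F =>
    demandLaw.bind fun d => s.seedLaw.map fun w => (F, d, w)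

/-- The demand vector `D`. -/
def demands (ω : s.Sample) : Demands K N := ω.2.1

/-- The demand `D_k`. -/
def demand (k : Fin K) (ω : s.Sample) : Fin N := ω.2.1 k

/-- The file `F_{D_k}` demanded by user `k`. -/
def demandedFile (k : Fin K) (ω : s.Sample) : Fin B → ZMod 2 := ω.1 (ω.2.1 k)

/-- The cache `Z_k`: metadata and content. -/
def cache (k : Fin K) (ω : s.Sample) : s.CacheMeta × s.Content :=
  (s.cacheMeta ω.2.2 k, s.content k (s.cacheMeta ω.2.2 k) ω.1)

/-- The metadata of the packets of user `k`. -/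
def packetMeta (k : Fin K) (ω : s.Sample) : s.TxMeta := s.txMeta ω.2.2 ω.2.1 k

/-- The signal `X_k` broadcast by user `k`: metadata and packets. -/
def signal (k : Fin K) (ω : s.Sample) : s.TxMeta × s.Payload :=
  (s.packetMeta k ω, s.payload k (s.packetMeta k ω) ω.1)

/-- All the signals `X`. -/
def signals (ω : s.Sample) : Fin K → s.TxMeta × s.Payload := fun k => s.signal k ω

/-- The constraints on a scheme for cache size `M` and load `R`, with slack `ε`. -/
structure IsValid (demandLaw : PMF (Demands K N)) (M R ε : ℝ) : Prop where
  /-- cache size constraint -/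
  memory : ∀ k, entropy (s.law demandLaw) (s.cache k) ≤ B * (M + ε)
  /-- encoding constraint: a user sends a function of its cache and of the server's metadata -/
  encoding : ∀ k, condEntropy (s.law demandLaw) (s.signal k)
    (fun ω => (s.packetMeta k ω, s.cache k ω)) = 0
  /-- decoding constraint -/
  decoding : ∀ k, condEntropy (s.law demandLaw) (s.demandedFile k)
    (fun ω => (s.signals ω, s.cache k ω, s.demand k ω)) ≤ B * ε
  /-- privacy constraint -/
  privacy : ∀ k, condMutualInfo (s.law demandLaw) s.demands
    (fun ω => (s.signals ω, s.cache k ω)) (s.demand k) = 0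
  /-- load -/
  load : ∑ k, entropy (s.law demandLaw) (s.signal k) ≤ B * (R + ε)

/-- Uncoded cache placement: each user copies some of the bits of the library, that is, what is
cached under given metadata amounts to the bits at certain positions. -/
def IsUncoded : Prop :=
  ∀ (k : Fin K) (m : s.CacheMeta), ∃ S : Set (Fin N × Fin B), ∀ F F' : Library N B,
    s.content k m F = s.content k m F' ↔ ∀ x ∈ S, F x.1 x.2 = F' x.1 x.2

end CachingScheme

/-- The load `R` is achievable at cache size `M` by schemes of the class `𝒮`: there are slacks
`ε_B ≥ 0` that tend to `0` such that, for all large file sizes `B`, a scheme of the class meets all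
the constraints. -/
def Achievable {K N : ℕ} (𝒮 : ∀ B : ℕ, CachingScheme K N B → Prop)
    (demandLaw : PMF (Demands K N)) (M R : ℝ) : Prop :=
  ∃ ε : ℕ → ℝ, (∀ B, 0 ≤ ε B) ∧ Tendsto ε atTop (𝓝 0) ∧
    ∀ᶠ B : ℕ in atTop, ∃ s : CachingScheme K N B, 𝒮 B s ∧ s.IsValid demandLaw M R (ε B)

/-- The class of the schemes with uncoded cache placement. -/
def UncodedPlacement (K N : ℕ) (B : ℕ) (s : CachingScheme K N B) : Prop := s.IsUncoded

/-! ## Scheme B -/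

namespace SchemeB

/-- `C(N-2, t-1)`, which is `0` for `t = 0`: the number of subfiles of a half-file that are cached
by the user that is not in charge of this half. -/
def sharedCount (N : ℕ) : ℕ → ℕ
  | 0 => 0
  | t + 1 => (N - 2).choose t

/-- `C(N-1, t) + C(N-2, t-1)`: the number of subfiles of a half-file. -/
def subfileCount (N t : ℕ) : ℕ := sharedCount N t + (N - 1).choose t

/-- The sets of `t + 1` files; one message is sent for each of them by each user. -/
abbrev Group (N t : ℕ) : Type := {S : Finset (Fin N) // S.card = t + 1}

/-- The position, in a file, of bit `b` of subfile `j` of the half-file of user `k`. -/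
def position {U ℓ : ℕ} (k : Fin 2) (j : Fin U) (b : Fin ℓ) : Fin (2 * (U * ℓ)) :=
  finProdFinEquiv (k, finProdFinEquiv (j, b))

/-- A rule that picks the subfiles for the messages of a user, when the other user demands `d`:
`pick d S i` is the rank, in the permuted list of subfiles, of the subfile of file `i ∈ S` in the
message of `S`. No subfile is picked twice. The other user caches the subfiles of rank less than
`sharedCount N t`; such a subfile is picked exactly when `d ∈ S` and `i ≠ d`. -/
structure IsPickRule (N t : ℕ)
    (pick : Fin N → (S : Group N t) → {i // i ∈ S.1} → Fin (subfileCount N t)) : Prop where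
  injective : ∀ (d i : Fin N) (S S' : Group N t) (h : i ∈ S.1) (h' : i ∈ S'.1),
    pick d S ⟨i, h⟩ = pick d S' ⟨i, h'⟩ → S = S'
  shared_iff : ∀ (d : Fin N) (S : Group N t) (i : {i // i ∈ S.1}),
    (pick d S i : ℕ) < sharedCount N t ↔ d ∈ S.1 ∧ i.1 ≠ d

/-- The scheme for one corner point, with subfiles of `ℓ` bits. For each user `k` and file `i`, a
uniform permutation `w k i` of the subfiles of the half-file of user `k` is drawn. User `k` caches
its half of each file, and the first `sharedCount N t` permuted subfiles of the other half. It
sends, for each set `S` of `t + 1` files, the sum modulo 2 of the picked subfiles of these files,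
taken from its half. -/
def corner (N t ℓ : ℕ)
    (pick : Fin N → (S : Group N t) → {i // i ∈ S.1} → Fin (subfileCount N t)) :
    CachingScheme 2 N (2 * (subfileCount N t * ℓ)) where
  Seed := Fin 2 → Fin N → Equiv.Perm (Fin (subfileCount N t))
  CacheMeta := Fin N → Fin (sharedCount N t) → Fin (subfileCount N t)
  Content := (Fin N → Fin (subfileCount N t) → Fin ℓ → ZMod 2) ×
    (Fin N → Fin (sharedCount N t) → Fin ℓ → ZMod 2)
  TxMeta := (S : Group N t) → {i // i ∈ S.1} → Fin (subfileCount N t)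
  Payload := Group N t → Fin ℓ → ZMod 2
  seedLaw := PMF.uniformOfFintype _
  cacheMeta w k := fun i j => w k.rev i (Fin.castAdd _ j)
  content k m F :=
    (fun i j b => F i (position k j b), fun i j b => F i (position k.rev (m i j) b))
  txMeta w d k := fun S i => w k i.1 (pick (d k.rev) S i)
  payload k m F := fun S b => ∑ i : {i // i ∈ S.1}, F i.1 (position k (m S i) b)

/-- The trivial scheme in which each user caches the whole library and nothing is sent. -/
def cacheAll (N B : ℕ) : CachingScheme 2 N B where
  Seed := Unit
  CacheMeta := Unit
  Content := Library N B
  TxMeta := Unit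
  Payload := Unit
  seedLaw := PMF.pure ()
  cacheMeta _ _ := ()
  content _ _ F := F
  txMeta _ _ _ := ()
  payload _ _ _ := ()

/-- Memory-sharing: each file is cut in two pieces, and a scheme is used for each piece, with
independent seeds. -/
def share {K N B₁ B₂ : ℕ} (s₁ : CachingScheme K N B₁) (s₂ : CachingScheme K N B₂) :
    CachingScheme K N (B₁ + B₂) where
  Seed := s₁.Seed × s₂.Seed
  CacheMeta := s₁.CacheMeta × s₂.CacheMeta
  Content := s₁.Content × s₂.Content
  TxMeta := s₁.TxMeta × s₂.TxMeta
  Payload := s₁.Payload × s₂.Payload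
  seedLaw := s₁.seedLaw.bind fun w₁ => s₂.seedLaw.map fun w₂ => (w₁, w₂)
  cacheMeta w k := (s₁.cacheMeta w.1 k, s₂.cacheMeta w.2 k)
  content k m F := (s₁.content k m.1 (fun i b => F i (Fin.castAdd B₂ b)),
    s₂.content k m.2 (fun i b => F i (Fin.natAdd B₁ b)))
  txMeta w d k := (s₁.txMeta w.1 d k, s₂.txMeta w.2 d k)
  payload k m F := (s₁.payload k m.1 (fun i b => F i (Fin.castAdd B₂ b)),
    s₂.payload k m.2 (fun i b => F i (Fin.natAdd B₁ b)))

/-- Scheme B for `N` files: the schemes of the corner points `t = 0, …, N - 1`, the trivial scheme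
of the corner point `(N, 0)`, and memory-sharing between them. -/
inductive IsSchemeB (N : ℕ) : ∀ B : ℕ, CachingScheme 2 N B → Prop
  | corner (t ℓ : ℕ) (ht : t < N)
      (pick : Fin N → (S : Group N t) → {i // i ∈ S.1} → Fin (subfileCount N t))
      (hpick : IsPickRule N t pick) : IsSchemeB N _ (corner N t ℓ pick)
  | cacheAll (B : ℕ) : IsSchemeB N B (cacheAll N B)
  | share {B₁ B₂ : ℕ} (s₁ : CachingScheme 2 N B₁) (s₂ : CachingScheme 2 N B₂)
      (h₁ : IsSchemeB N B₁ s₁) (h₂ : IsSchemeB N B₂ s₂) : IsSchemeB N (B₁ + B₂) (share s₁ s₂)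

/-- The corner points (cache size, load) of Scheme B. -/
def cornerPoints (N : ℕ) : Set (ℝ × ℝ) :=
  {((N : ℝ), (0 : ℝ))} ∪
    {x | ∃ t : ℕ, t < N ∧
      x = ((N : ℝ) / 2 + (N : ℝ) * t / (2 * ((N : ℝ) + t - 1)),
        (N : ℝ) * ((N : ℝ) - 1) / (((t : ℝ) + 1) * ((N : ℝ) + t - 1)))}

/-- The lower convex envelope, at `M`, of the corner points of Scheme B. -/
def load (N : ℕ) (M : ℝ) : ℝ := sInf {r : ℝ | (M, r) ∈ convexHull ℝ (cornerPoints N)}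

end SchemeB

end

/-!
Converse: under uncoded placement the metadata alone say which bits a user caches. Fix the demands
`(f₁, f₁)`. By privacy the metadata that the server sends for these demands are compatible, for each
user, with a cache that would have allowed this user to decode any other file `f₂` or `f₃` from the
same two packets. Adding these resampled caches one after the other in a submodularity argument
bounds the entropy of each packet, and a count of bit positions, one file at a time, turns the sum
of the two bounds into a linear inequality between the load and the numbers of uncached bits, with
weight `i` on the file `fᵢ`. Averaging it over the cyclic shifts of the files yields the segment of
the convex envelope on which one, two or three files are involved.

Achievability: a user sees the random permutations of its own half only through the picked
subfiles. As no subfile is picked twice, the law of the metadata it sees does not depend on the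
demand of the other user. The points of the envelope between the corner points are reached by
memory-sharing, with a number of bits of overhead that does not grow with the file size.
-/

noncomputable section

section Expectation

variable {Ω Θ α : Type} [Fintype Ω] [Fintype Θ]

/-- The expectation of a real random variable on a finite probability space. -/
def expect (P : PMF Ω) (g : Ω → ℝ) : ℝ := ∑ ω, (P ω).toReal * g ω

theorem expect_const (P : PMF Ω) (c : ℝ) : expect P (fun _ => c) = c := by
  have hP : ∑ ω, (P ω).toReal = 1 := by
    rw [← ENNReal.toReal_sum fun ω _ => P.apply_ne_top ω,
      ← tsum_fintype (L := .unconditional _), P.tsum_coe, ENNReal.toReal_one]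
  rw [expect, ← Finset.sum_mul, hP, one_mul]

theorem expect_add (P : PMF Ω) (f g : Ω → ℝ) :
    expect P (fun ω => f ω + g ω) = expect P f + expect P g := by
  simp only [expect, mul_add, Finset.sum_add_distrib]

theorem expect_sub (P : PMF Ω) (f g : Ω → ℝ) :
    expect P (fun ω => f ω - g ω) = expect P f - expect P g := by
  simp only [expect, mul_sub, Finset.sum_sub_distrib]

theorem expect_neg (P : PMF Ω) (f : Ω → ℝ) : expect P (fun ω => -f ω) = -expect P f := by
  simp only [expect, mul_neg, Finset.sum_neg_distrib]

theorem expect_const_mul (P : PMF Ω) (c : ℝ) (f : Ω → ℝ) :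
    expect P (fun ω => c * f ω) = c * expect P f := by
  simp only [expect, Finset.mul_sum, mul_left_comm]

theorem expect_sum {ι : Type*} (P : PMF Ω) (t : Finset ι) (f : ι → Ω → ℝ) :
    expect P (fun ω => ∑ i ∈ t, f i ω) = ∑ i ∈ t, expect P (f i) := by
  simp only [expect, Finset.mul_sum]
  exact Finset.sum_comm

theorem expect_mono {P : PMF Ω} {f g : Ω → ℝ} (h : ∀ ω ∈ P.support, f ω ≤ g ω) :
    expect P f ≤ expect P g := by
  refine Finset.sum_le_sum fun ω _ => ?_
  by_cases hω : ω ∈ P.support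
  · exact mul_le_mul_of_nonneg_left (h ω hω) ENNReal.toReal_nonneg
  · simp [(P.apply_eq_zero_iff ω).2 hω]

theorem expect_congr {P : PMF Ω} {f g : Ω → ℝ} (h : ∀ ω ∈ P.support, f ω = g ω) :
    expect P f = expect P g :=
  le_antisymm (expect_mono fun ω hω => (h ω hω).le) (expect_mono fun ω hω => (h ω hω).ge)

theorem expect_nonneg (P : PMF Ω) {g : Ω → ℝ} (hg : ∀ ω, 0 ≤ g ω) : 0 ≤ expect P g :=
  Finset.sum_nonneg fun ω _ => mul_nonneg ENNReal.toReal_nonneg (hg ω)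

theorem mul_le_expect (P : PMF Ω) {g : Ω → ℝ} (hg : ∀ ω, 0 ≤ g ω) (ω : Ω) :
    (P ω).toReal * g ω ≤ expect P g :=
  Finset.single_le_sum (f := fun ω => (P ω).toReal * g ω)
    (fun ω _ => mul_nonneg ENNReal.toReal_nonneg (hg ω)) (Finset.mem_univ ω)

theorem toReal_pos_of_mem_support {Ω : Type} {P : PMF Ω} {ω : Ω} (hω : ω ∈ P.support) :
    0 < (P ω).toReal :=
  ENNReal.toReal_pos hω (P.apply_ne_top ω)

theorem eq_zero_of_expect_eq_zero {P : PMF Ω} {g : Ω → ℝ} (hg : ∀ ω, 0 ≤ g ω)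
    (h : expect P g = 0) {ω : Ω} (hω : ω ∈ P.support) : g ω = 0 :=
  (nonpos_of_mul_nonpos_right (h ▸ mul_le_expect P hg ω) (toReal_pos_of_mem_support hω)).antisymm
    (hg ω)

/-- The joint law of two independent random variables with the given laws. -/
def prodLaw {Ω Θ : Type} (u : PMF Ω) (v : PMF Θ) : PMF (Ω × Θ) :=
  u.bind fun a => v.map fun b => (a, b)

theorem prodLaw_apply {Ω Θ : Type} (u : PMF Ω) (v : PMF Θ) (a : Ω) (b : Θ) :
    prodLaw u v (a, b) = u a * v b := by
  classical
  rw [prodLaw, PMF.bind_apply, tsum_eq_single a]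
  · congr 1
    rw [PMF.map_apply, tsum_eq_single b]
    · exact if_pos rfl
    · intro b' hb
      exact if_neg fun h => hb (Prod.mk.inj h).2.symm
  · intro a' ha
    refine mul_eq_zero_of_right _ ((PMF.apply_eq_zero_iff _ _).2 fun h => ?_)
    obtain ⟨b', -, h⟩ := (PMF.mem_support_map_iff _ _ _).1 h
    exact ha (Prod.mk.inj h).1

theorem expect_prodLaw (u : PMF Ω) (v : PMF Θ) (g : Ω × Θ → ℝ) :
    expect (prodLaw u v) g = expect u fun a => expect v fun b => g (a, b) := by
  simp only [expect, Fintype.sum_prod_type, prodLaw_apply, ENNReal.toReal_mul, Finset.mul_sum,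
    mul_assoc]

theorem expect_prodLaw_right (u : PMF Ω) (v : PMF Θ) (g : Ω × Θ → ℝ) :
    expect (prodLaw u v) g = expect v fun b => expect u fun a => g (a, b) := by
  rw [expect_prodLaw]
  simp only [expect, Finset.mul_sum]
  rw [Finset.sum_comm]
  simp only [mul_left_comm]

/-- The probability `P(X = x)`, as a real number. -/
def probEq {Ω : Type} (P : PMF Ω) (X : Ω → α) (x : α) : ℝ := (P.map X x).toReal

theorem probEq_nonneg {Ω : Type} (P : PMF Ω) (X : Ω → α) (x : α) : 0 ≤ probEq P X x :=
  ENNReal.toReal_nonneg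

theorem probEq_id {Ω : Type} (P : PMF Ω) (ω : Ω) : probEq P id ω = (P ω).toReal := by
  rw [probEq, PMF.map_id]

theorem probEq_eq_expect [DecidableEq α] (P : PMF Ω) (X : Ω → α) (x : α) :
    probEq P X x = expect P fun ω => if X ω = x then 1 else 0 := by
  rw [probEq, PMF.map_apply, tsum_fintype, ENNReal.toReal_sum, expect]
  · refine Finset.sum_congr rfl fun ω _ => ?_
    simp only [eq_comm (a := x)]
    split_ifs <;> simp
  · intro ω _
    split_ifs
    · exact P.apply_ne_top ω
    · exact ENNReal.zero_ne_top

theorem sum_probEq_mul [Fintype α] (P : PMF Ω) (X : Ω → α) (g : α → ℝ) :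
    ∑ x, probEq P X x * g x = expect P fun ω => g (X ω) := by
  classical
  simp only [probEq_eq_expect, mul_comm _ (g _), ← expect_const_mul, ← expect_sum]
  simp

theorem sum_probEq [Fintype α] (P : PMF Ω) (X : Ω → α) : ∑ x, probEq P X x = 1 := by
  simpa only [mul_one, expect_const] using sum_probEq_mul P X fun _ => 1

theorem expect_map [Fintype α] (P : PMF Ω) (X : Ω → α) (g : α → ℝ) :
    expect (P.map X) g = expect P fun ω => g (X ω) :=
  sum_probEq_mul P X g

theorem expect_congr_of_map_eq [Fintype α] {P : PMF Ω} {X X' : Ω → α} (h : P.map X = P.map X')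
    (g : α → ℝ) : expect P (fun ω => g (X ω)) = expect P fun ω => g (X' ω) := by
  rw [← expect_map, h, expect_map]

theorem probEq_mono {β : Type} (P : PMF Ω) {X : Ω → α} {Y : Ω → β} {x : α} {y : β}
    (h : ∀ ω, X ω = x → Y ω = y) : probEq P X x ≤ probEq P Y y := by
  classical
  rw [probEq_eq_expect, probEq_eq_expect]
  refine expect_mono fun ω _ => ?_
  by_cases hx : X ω = x
  · rw [if_pos hx, if_pos (h ω hx)]
  · rw [if_neg hx]
    split_ifs <;> norm_num

theorem probEq_pos {Ω : Type} {P : PMF Ω} {ω : Ω} (X : Ω → α) (hω : ω ∈ P.support) :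
    0 < probEq P X (X ω) :=
  ENNReal.toReal_pos ((PMF.mem_support_iff _ _).1 <|
    (PMF.mem_support_map_iff X P _).2 ⟨ω, hω, rfl⟩) (PMF.apply_ne_top _ _)

theorem sum_probEq_pair_left {β : Type} [Fintype α] (P : PMF Ω) (X : Ω → α) (Y : Ω → β)
    (y : β) : ∑ x, probEq P (fun ω => (X ω, Y ω)) (x, y) = probEq P Y y := by
  classical
  simp only [probEq_eq_expect, ← expect_sum, Prod.mk.injEq, and_comm (b := _ = y), ite_and]
  congr with ω
  split_ifs <;> simp

end Expectation

section Entropy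

variable {Ω α β γ : Type} [Fintype Ω] [Fintype α] [Fintype β] [Fintype γ] (P : PMF Ω)

theorem entropy_mul_log (X : Ω → α) :
    entropy P X * Real.log 2 = -expect P fun ω => Real.log (probEq P X (X ω)) := by
  rw [entropy, div_mul_cancel₀ _ (Real.log_pos one_lt_two).ne',
    ← sum_probEq_mul P X fun x => Real.log (probEq P X x), ← Finset.sum_neg_distrib]
  simp only [Real.negMulLog, probEq, neg_mul]

theorem entropy_le_of_determined {X : Ω → α} {Y : Ω → β}
    (h : ∀ ω ω', Y ω = Y ω' → X ω = X ω') : entropy P X ≤ entropy P Y := by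
  rw [← mul_le_mul_iff_left₀ (Real.log_pos one_lt_two), entropy_mul_log, entropy_mul_log,
    neg_le_neg_iff]
  exact expect_mono fun ω hω => Real.log_le_log (probEq_pos Y hω) <|
    probEq_mono P fun ω' h' => h ω' ω h'

theorem entropy_congr {X : Ω → α} {Y : Ω → β} (h : ∀ ω ω', Y ω = Y ω' ↔ X ω = X ω') :
    entropy P X = entropy P Y :=
  le_antisymm (entropy_le_of_determined P fun ω ω' => (h ω ω').1)
    (entropy_le_of_determined P fun ω ω' => (h ω ω').2)

theorem condEntropy_congr {α' β' : Type} [Fintype α'] [Fintype β'] {X : Ω → α} {X' : Ω → α'}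
    {Y : Ω → β} {Y' : Ω → β'} (hX : ∀ ω ω', Y ω = Y ω' → (X ω = X ω' ↔ X' ω = X' ω'))
    (hY : ∀ ω ω', Y ω = Y ω' ↔ Y' ω = Y' ω') : condEntropy P X Y = condEntropy P X' Y' := by
  rw [condEntropy, condEntropy, entropy_congr P (X := Y) (Y := Y') fun ω ω' => (hY ω ω').symm]
  congr 1
  refine entropy_congr P fun ω ω' => ?_
  rw [Prod.mk.injEq, Prod.mk.injEq, ← hY]
  exact (and_congr_left (hX ω ω')).symm

theorem condEntropy_eq_zero_of_determined {X : Ω → α} {Y : Ω → β}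
    (h : ∀ ω ω', Y ω = Y ω' → X ω = X ω') : condEntropy P X Y = 0 := by
  rw [condEntropy, sub_eq_zero]
  refine entropy_congr P fun ω ω' => ?_
  rw [Prod.mk.injEq]
  exact ⟨fun h' => ⟨h _ _ h', h'⟩, And.right⟩

theorem condEntropy_nonneg (X : Ω → α) (Y : Ω → β) : 0 ≤ condEntropy P X Y :=
  sub_nonneg.2 <| entropy_le_of_determined P fun _ _ h => (Prod.mk.inj h).2

theorem entropy_const (c : α) : entropy P (fun _ => c) = 0 := by
  classical
  have hc : probEq P (fun _ : Ω => c) c = 1 := by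
    simp only [probEq_eq_expect, if_true, expect_const]
  have h := entropy_mul_log P fun _ : Ω => c
  rw [hc, Real.log_one, expect_const, neg_zero] at h
  exact (mul_eq_zero.1 h).resolve_right (Real.log_pos one_lt_two).ne'

section Gibbs

variable {f g : α → ℝ}

theorem sum_mul_log_div_eq_sum_klFun (hfg : ∀ x, g x = 0 → f x = 0)
    (hsum : ∑ x, f x = ∑ x, g x) :
    ∑ x, f x * Real.log (f x / g x) = ∑ x, g x * InformationTheory.klFun (f x / g x) := by
  rw [← add_zero (∑ x, f x * Real.log (f x / g x)), ← sub_self (∑ x, g x)]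
  nth_rw 2 [← hsum]
  rw [← Finset.sum_sub_distrib, ← Finset.sum_add_distrib]
  refine Finset.sum_congr rfl fun x _ => ?_
  rw [InformationTheory.klFun]
  rcases eq_or_ne (g x) 0 with h | h
  · simp [h, hfg x h]
  · field_simp
    ring

theorem sum_mul_log_div_nonneg (hf : ∀ x, 0 ≤ f x) (hg : ∀ x, 0 ≤ g x)
    (hfg : ∀ x, g x = 0 → f x = 0) (hsum : ∑ x, f x = ∑ x, g x) :
    0 ≤ ∑ x, f x * Real.log (f x / g x) := by
  rw [sum_mul_log_div_eq_sum_klFun hfg hsum]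
  exact Finset.sum_nonneg fun x _ =>
    mul_nonneg (hg x) (InformationTheory.klFun_nonneg (div_nonneg (hf x) (hg x)))

theorem sum_mul_log_div_eq_zero_iff (hf : ∀ x, 0 ≤ f x) (hg : ∀ x, 0 ≤ g x)
    (hfg : ∀ x, g x = 0 → f x = 0) (hsum : ∑ x, f x = ∑ x, g x) :
    ∑ x, f x * Real.log (f x / g x) = 0 ↔ ∀ x, f x = g x := by
  have hfg0 : ∀ x, 0 ≤ f x / g x := fun x => div_nonneg (hf x) (hg x)
  rw [sum_mul_log_div_eq_sum_klFun hfg hsum, Finset.sum_eq_zero_iff_of_nonneg fun x _ =>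
    mul_nonneg (hg x) (InformationTheory.klFun_nonneg (hfg0 x))]
  simp only [Finset.mem_univ, true_implies]
  refine forall_congr' fun x => ?_
  rw [mul_eq_zero, InformationTheory.klFun_eq_zero_iff (hfg0 x)]
  rcases eq_or_ne (g x) 0 with h | h
  · simp [h, hfg x h]
  · simp [h, div_eq_one_iff_eq h]

end Gibbs

theorem entropy_le_logb_card [Nonempty α] (X : Ω → α) :
    entropy P X ≤ Real.logb 2 (Fintype.card α) := by
  have hc : (0 : ℝ) < Fintype.card α := by exact_mod_cast Fintype.card_pos
  rw [Real.logb, le_div_iff₀ (Real.log_pos one_lt_two)]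
  have h : 0 ≤ ∑ x, probEq P X x * Real.log (probEq P X x / (Fintype.card α : ℝ)⁻¹) :=
    sum_mul_log_div_nonneg (probEq_nonneg P X) (fun _ => by positivity)
      (fun x h => absurd h (by positivity)) (by simp [sum_probEq, hc.ne'])
  rw [sum_probEq_mul P X fun x => Real.log (probEq P X x / (Fintype.card α : ℝ)⁻¹)] at h
  have hlog : ∀ ω ∈ P.support, Real.log (probEq P X (X ω) / (Fintype.card α : ℝ)⁻¹) =
      Real.log (probEq P X (X ω)) + Real.log (Fintype.card α) := fun ω hω => by
    rw [div_inv_eq_mul, Real.log_mul (probEq_pos X hω).ne' hc.ne']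
  rw [expect_congr hlog, expect_add, expect_const] at h
  linarith [entropy_mul_log P X]

theorem entropy_uniformOfFintype_id [Nonempty Ω] :
    entropy (PMF.uniformOfFintype Ω) id = Real.logb 2 (Fintype.card Ω) := by
  have h : ∀ ω : Ω, probEq (PMF.uniformOfFintype Ω) id ω = (Fintype.card Ω : ℝ)⁻¹ := fun ω => by
    rw [probEq_id, PMF.uniformOfFintype_apply, ENNReal.toReal_inv, ENNReal.toReal_natCast]
  rw [Real.logb, eq_div_iff (Real.log_pos one_lt_two).ne', entropy_mul_log]
  simp only [id, h, expect_const, Real.log_inv, neg_neg]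

/-- The probability that `(X, Y, Z) = t` would have if `X` and `Y` were conditionally independent
given `Z`. It is `0` where `Z` has probability `0`, by the convention `x / 0 = 0`. -/
def condIndepProb {Ω α β γ : Type} (P : PMF Ω) (X : Ω → α) (Y : Ω → β) (Z : Ω → γ)
    (t : α × β × γ) : ℝ :=
  probEq P (fun ω => (X ω, Z ω)) (t.1, t.2.2) * probEq P (fun ω => (Y ω, Z ω)) t.2 /
    probEq P Z t.2.2

theorem condIndepProb_nonneg {Ω α β γ : Type} (P : PMF Ω) (X : Ω → α) (Y : Ω → β) (Z : Ω → γ)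
    (t : α × β × γ) : 0 ≤ condIndepProb P X Y Z t :=
  div_nonneg (mul_nonneg (probEq_nonneg _ _ _) (probEq_nonneg _ _ _)) (probEq_nonneg _ _ _)

theorem probEq_eq_zero_of_condIndepProb_eq_zero {α β γ : Type} {P : PMF Ω} {X : Ω → α}
    {Y : Ω → β} {Z : Ω → γ} {t : α × β × γ} (ht : condIndepProb P X Y Z t = 0) :
    probEq P (fun ω => (X ω, Y ω, Z ω)) t = 0 := by
  refine le_antisymm ?_ (probEq_nonneg _ _ _)
  obtain (h | h) | h := (div_eq_zero_iff.1 ht).imp_left mul_eq_zero.1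
  all_goals exact h ▸ probEq_mono P fun ω h => by rw [← h]

theorem sum_condIndepProb (X : Ω → α) (Y : Ω → β) (Z : Ω → γ) :
    ∑ t, condIndepProb P X Y Z t = 1 := by
  rw [Fintype.sum_prod_type_right, ← sum_probEq P fun ω => (Y ω, Z ω)]
  refine Finset.sum_congr rfl fun ⟨y, z⟩ _ => ?_
  simp only [condIndepProb]
  rw [← Finset.sum_div, ← Finset.sum_mul, sum_probEq_pair_left]
  rcases eq_or_ne (probEq P Z z) 0 with h | h
  · rw [h, zero_mul, zero_div]
    exact le_antisymm (probEq_nonneg _ _ _) (h ▸ probEq_mono P fun ω h => (Prod.mk.inj h).2)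
  · rw [mul_div_cancel_left₀ _ h]

theorem condMutualInfo_mul_log (X : Ω → α) (Y : Ω → β) (Z : Ω → γ) :
    condMutualInfo P X Y Z * Real.log 2 =
      ∑ t, probEq P (fun ω => (X ω, Y ω, Z ω)) t *
        Real.log (probEq P (fun ω => (X ω, Y ω, Z ω)) t / condIndepProb P X Y Z t) := by
  rw [sum_probEq_mul P _ fun t => Real.log (probEq P _ t / condIndepProb P X Y Z t),
    condMutualInfo, condEntropy, condEntropy]
  simp only [sub_mul, entropy_mul_log, ← expect_neg, ← expect_sub]
  refine expect_congr fun ω hω => ?_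
  have hXZ := probEq_pos (fun ω => (X ω, Z ω)) hω
  have hYZ := probEq_pos (fun ω => (Y ω, Z ω)) hω
  have hZ := probEq_pos Z hω
  rw [condIndepProb, Real.log_div (probEq_pos _ hω).ne' (by positivity),
    Real.log_div (by positivity) hZ.ne', Real.log_mul hXZ.ne' hYZ.ne']
  ring

theorem condMutualInfo_nonneg (X : Ω → α) (Y : Ω → β) (Z : Ω → γ) :
    0 ≤ condMutualInfo P X Y Z := by
  refine nonneg_of_mul_nonneg_left ?_ (Real.log_pos one_lt_two)
  rw [condMutualInfo_mul_log]
  exact sum_mul_log_div_nonneg (probEq_nonneg P _) (condIndepProb_nonneg P X Y Z)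
    (fun _ => probEq_eq_zero_of_condIndepProb_eq_zero) (by rw [sum_probEq, sum_condIndepProb])

theorem condMutualInfo_eq_zero_iff (X : Ω → α) (Y : Ω → β) (Z : Ω → γ) :
    condMutualInfo P X Y Z = 0 ↔
      ∀ t, probEq P (fun ω => (X ω, Y ω, Z ω)) t = condIndepProb P X Y Z t := by
  rw [← mul_eq_zero_iff_right (Real.log_pos one_lt_two).ne', condMutualInfo_mul_log]
  exact sum_mul_log_div_eq_zero_iff (probEq_nonneg P _) (condIndepProb_nonneg P X Y Z)
    (fun _ => probEq_eq_zero_of_condIndepProb_eq_zero) (by rw [sum_probEq, sum_condIndepProb])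

theorem condEntropy_pair_le (X : Ω → α) (Y : Ω → β) (Z : Ω → γ) :
    condEntropy P X (fun ω => (Y ω, Z ω)) ≤ condEntropy P X Z :=
  sub_nonneg.1 (condMutualInfo_nonneg P X Y Z)

theorem condEntropy_le_of_determined (X : Ω → α) {Y : Ω → β} {Z : Ω → γ}
    (h : ∀ ω ω', Y ω = Y ω' → Z ω = Z ω') : condEntropy P X Y ≤ condEntropy P X Z := by
  refine le_trans (le_of_eq ?_) (condEntropy_pair_le P X Y Z)
  refine condEntropy_congr P (fun _ _ _ => Iff.rfl) fun ω ω' => ?_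
  rw [Prod.mk.injEq]
  exact ⟨fun h' => ⟨h', h _ _ h'⟩, And.left⟩

theorem condEntropy_le_entropy (X : Ω → α) (Y : Ω → β) : condEntropy P X Y ≤ entropy P X := by
  refine (condEntropy_le_of_determined P X (Z := fun _ => ()) fun _ _ _ => rfl).trans ?_
  rw [condEntropy, entropy_const, sub_zero]
  exact entropy_le_of_determined P fun _ _ h => by rw [h]

theorem entropy_pair_le (X : Ω → α) (Y : Ω → β) :
    entropy P (fun ω => (X ω, Y ω)) ≤ entropy P X + entropy P Y :=
  sub_le_iff_le_add.1 (condEntropy_le_entropy P X Y)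

end Entropy

section Independence

variable {Ω Θ α β : Type} [Fintype Ω] [Fintype Θ] [Fintype α] [Fintype β]
  (u : PMF Ω) (v : PMF Θ)

theorem probEq_prodLaw_comp_fst {γ : Type} (f : Ω → γ) (c : γ) :
    probEq (prodLaw u v) (fun ω => f ω.1) c = probEq u f c := by
  classical
  rw [probEq_eq_expect, probEq_eq_expect, expect_prodLaw]
  exact expect_congr fun a _ => expect_const v (if f a = c then 1 else 0)

theorem probEq_prodLaw_pair_snd {α : Type} (Y : Ω × Θ → α) (y : α) (b : Θ) :
    probEq (prodLaw u v) (fun ω => (Y ω, ω.2)) (y, b) =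
      (v b).toReal * probEq u (fun a => Y (a, b)) y := by
  classical
  simp only [probEq_eq_expect, expect_prodLaw_right, Prod.mk.injEq, and_comm (b := _ = b),
    ite_and]
  rw [expect, Finset.sum_eq_single_of_mem b (Finset.mem_univ b)]
  · simp only [if_true]
  · intro b' _ hb
    simp only [if_neg hb, expect_const, mul_zero]

theorem entropy_prodLaw_pair_snd (Y : Ω × Θ → α) :
    entropy (prodLaw u v) (fun ω => (Y ω, ω.2)) =
      entropy v id + expect v fun b => entropy u fun a => Y (a, b) := by
  apply mul_right_cancel₀ (Real.log_pos one_lt_two).ne'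
  rw [add_mul, mul_comm (expect _ _), ← expect_const_mul]
  simp only [mul_comm (Real.log 2), entropy_mul_log]
  rw [expect_neg, ← neg_add, ← expect_add, expect_prodLaw_right]
  congr 1
  refine expect_congr fun b hb => ?_
  rw [← expect_const u (Real.log _), ← expect_add]
  refine expect_congr fun a ha => ?_
  rw [probEq_prodLaw_pair_snd, Real.log_mul _ (probEq_pos (fun a => Y (a, b)) ha).ne', id,
    probEq_id]
  exact ENNReal.toReal_ne_zero.2 ⟨hb, v.apply_ne_top b⟩

theorem entropy_prodLaw_snd : entropy (prodLaw u v) Prod.snd = entropy v id := by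
  have h := entropy_prodLaw_pair_snd u v fun _ => ()
  simp only [entropy_const, expect_const, add_zero] at h
  rw [← h]
  exact entropy_congr _ fun _ _ => by simp only [Prod.mk.injEq, true_and]

theorem expect_entropy_le (Y : Ω × Θ → α) :
    expect v (fun b => entropy u fun a => Y (a, b)) ≤ entropy (prodLaw u v) Y := by
  have h := condEntropy_le_entropy (prodLaw u v) Y Prod.snd
  rw [condEntropy, entropy_prodLaw_pair_snd, entropy_prodLaw_snd] at h
  linarith

theorem expect_condEntropy_le (X : Ω × Θ → α) (Y : Ω × Θ → β) :
    expect v (fun b => condEntropy u (fun a => X (a, b)) fun a => Y (a, b)) ≤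
      condEntropy (prodLaw u v) X Y := by
  refine le_trans (le_of_eq ?_) (condEntropy_le_of_determined _ X (Y := fun ω => (Y ω, ω.2))
    fun ω ω' h => (Prod.mk.inj h).1)
  have hassoc : entropy (prodLaw u v) (fun ω => (X ω, Y ω, ω.2)) =
      entropy (prodLaw u v) fun ω => ((X ω, Y ω), ω.2) :=
    entropy_congr _ fun _ _ => by simp only [Prod.mk.injEq, and_assoc]
  rw [condEntropy, hassoc, entropy_prodLaw_pair_snd, entropy_prodLaw_pair_snd,
    add_sub_add_left_eq_sub, ← expect_sub]
  rfl

section Privacy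

variable {γ : Type} [DecidableEq γ] (g : Ω → γ)

theorem probEq_prodLaw_fst {β : Type} (Y : Ω × Θ → β) (a : Ω) (y : β) (c : γ) :
    probEq (prodLaw u v) (fun ω => (ω.1, Y ω, g ω.1)) (a, y, c) =
      if g a = c then (u a).toReal * probEq v (fun b => Y (a, b)) y else 0 := by
  classical
  simp only [probEq_eq_expect, expect_prodLaw, Prod.mk.injEq, ite_and]
  rw [expect, Finset.sum_eq_single_of_mem a (Finset.mem_univ a)]
  · by_cases hc : g a = c
    · simp only [hc, if_true]
    · simp only [hc, if_false, ite_self, expect_const, mul_zero]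
  · intro a' _ ha
    simp only [if_neg ha, expect_const, mul_zero]

theorem condIndepProb_prodLaw {β : Type} (Y : Ω × Θ → β) (a : Ω) (y : β) (c : γ) :
    condIndepProb (prodLaw u v) Prod.fst Y (fun ω => g ω.1) (a, y, c) =
      if g a = c then (u a).toReal * (probEq (prodLaw u v) (fun ω => (Y ω, g ω.1)) (y, c) /
        probEq (prodLaw u v) (fun ω => g ω.1) c) else 0 := by
  have hfst : probEq (prodLaw u v) (fun ω => (ω.1, g ω.1)) (a, c) =
      if g a = c then (u a).toReal else 0 := by
    classical
    rw [probEq_prodLaw_comp_fst u v fun a => (a, g a), probEq_eq_expect, expect,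
      Finset.sum_eq_single_of_mem a (Finset.mem_univ a) fun a' _ ha => by
        rw [if_neg fun h => ha (Prod.mk.inj h).1, mul_zero]]
    simp only [Prod.mk.injEq, true_and, mul_ite, mul_one, mul_zero]
  rw [condIndepProb, hfst]
  split_ifs
  · rw [mul_div_assoc]
  · rw [zero_mul, zero_div]

theorem probEq_prodLaw_pair_comp_fst {β : Type} (Y : Ω × Θ → β) (y : β) (c : γ) :
    probEq (prodLaw u v) (fun ω => (Y ω, g ω.1)) (y, c) =
      expect u fun a => if g a = c then probEq v (fun b => Y (a, b)) y else 0 := by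
  classical
  simp only [probEq_eq_expect, expect_prodLaw, Prod.mk.injEq, and_comm (b := _ = c), ite_and]
  congr with a
  split_ifs <;> simp only [expect_const]

theorem condMutualInfo_prodLaw_eq_zero_iff {γ : Type} [Fintype γ] (g : Ω → γ) (Y : Ω × Θ → β) :
    condMutualInfo (prodLaw u v) Prod.fst Y (fun ω => g ω.1) = 0 ↔
      ∀ a ∈ u.support, ∀ a' ∈ u.support, g a = g a' →
        v.map (fun b => Y (a, b)) = v.map (fun b => Y (a', b)) := by
  classical
  have hcond : condMutualInfo (prodLaw u v) Prod.fst Y (fun ω => g ω.1) = 0 ↔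
      ∀ a ∈ u.support, ∀ y, probEq v (fun b => Y (a, b)) y =
        probEq (prodLaw u v) (fun ω => (Y ω, g ω.1)) (y, g a) /
          probEq (prodLaw u v) (fun ω => g ω.1) (g a) := by
    rw [condMutualInfo_eq_zero_iff]
    simp only [Prod.forall, probEq_prodLaw_fst, condIndepProb_prodLaw]
    refine forall_congr' fun a => ⟨fun h ha y => ?_, fun h y c => ?_⟩
    · have hy := h y (g a)
      simp only [if_true] at hy
      exact mul_left_cancel₀ (ENNReal.toReal_ne_zero.2 ⟨ha, u.apply_ne_top a⟩) hy
    · split_ifs with hc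
      · by_cases ha : a ∈ u.support
        · rw [← hc, h ha]
        · rw [(u.apply_eq_zero_iff a).2 ha, ENNReal.toReal_zero, zero_mul, zero_mul]
      · rfl
  rw [hcond]
  refine ⟨fun h a ha a' ha' hg => PMF.ext fun y => ?_, fun h a ha y => ?_⟩
  · rw [← ENNReal.toReal_eq_toReal_iff' (PMF.apply_ne_top _ _) (PMF.apply_ne_top _ _)]
    exact (h a ha y).trans (hg ▸ (h a' ha' y).symm)
  · rw [probEq_prodLaw_comp_fst, eq_div_iff (probEq_pos g ha).ne', probEq_prodLaw_pair_comp_fst,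
      probEq_eq_expect _ g, ← expect_const_mul]
    refine expect_congr fun a' ha' => ?_
    split_ifs with hg
    · rw [mul_one, probEq, probEq, h a ha a' ha' hg.symm]
    · rw [mul_zero]

end Privacy

end Independence

section Bits

variable {N B : ℕ}

/-- The bits of the library at the positions in `T`, padded with zeros so that the type of the
values does not depend on `T`. -/
def bits (T : Finset (Fin N × Fin B)) (F : Library N B) : Fin N × Fin B → ZMod 2 :=
  fun x => if x ∈ T then F x.1 x.2 else 0

theorem bits_eq_iff {T : Finset (Fin N × Fin B)} {F F' : Library N B} :
    bits T F = bits T F' ↔ ∀ x ∈ T, F x.1 x.2 = F' x.1 x.2 := by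
  rw [funext_iff]
  refine forall_congr' fun x => ?_
  by_cases h : x ∈ T <;> simp [bits, h]

theorem bits_eq_of_subset {T U : Finset (Fin N × Fin B)} (h : T ⊆ U) {F F' : Library N B}
    (hF : bits U F = bits U F') : bits T F = bits T F' :=
  bits_eq_iff.2 fun x hx => bits_eq_iff.1 hF x (h hx)

theorem bits_union_eq_iff {T U : Finset (Fin N × Fin B)} {F F' : Library N B} :
    bits (T ∪ U) F = bits (T ∪ U) F' ↔ bits T F = bits T F' ∧ bits U F = bits U F' := by
  simp only [bits_eq_iff, Finset.mem_union, or_imp, forall_and]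

/-- The positions of the bits of file `j`. -/
def row (j : Fin N) : Finset (Fin N × Fin B) := {j} ×ˢ Finset.univ

theorem mem_row {j : Fin N} {x : Fin N × Fin B} : x ∈ row j ↔ x.1 = j := by
  simp only [row, Finset.mem_product, Finset.mem_singleton, Finset.mem_univ, and_true]

theorem card_row (j : Fin N) : (row j : Finset (Fin N × Fin B)).card = B := by simp [row]

theorem sum_card_row_sdiff (T : Finset (Fin N × Fin B)) :
    ∑ j, ((row j \ T).card : ℝ) = N * B - T.card := by
  have hfiber : Tᶜ.card = ∑ j : Fin N, (row j \ T).card := by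
    rw [Finset.card_eq_sum_card_fiberwise (f := Prod.fst) (t := Finset.univ)
      fun x _ => Finset.mem_coe.2 (Finset.mem_univ x.1)]
    refine Finset.sum_congr rfl fun j _ => congrArg Finset.card ?_
    ext x
    rw [Finset.mem_filter, Finset.mem_compl, Finset.mem_sdiff, mem_row, and_comm]
  have hcompl := Finset.card_add_card_compl T
  rw [Fintype.card_prod, Fintype.card_fin, Fintype.card_fin, hfiber] at hcompl
  rw [eq_sub_iff_add_eq, add_comm]
  exact_mod_cast hcompl

theorem bits_row_eq_iff {j : Fin N} {F F' : Library N B} :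
    bits (row j) F = bits (row j) F' ↔ F j = F' j := by
  rw [bits_eq_iff, funext_iff]
  refine ⟨fun h b => h (j, b) (mem_row.2 rfl), fun h x hx => ?_⟩
  rw [mem_row.1 hx, h]

variable (N B) in
/-- The law of the library. -/
abbrev uniformLibrary : PMF (Library N B) := PMF.uniformOfFintype (Library N B)

theorem entropy_bits_le (T : Finset (Fin N × Fin B)) :
    entropy (uniformLibrary N B) (bits T) ≤ T.card := by
  have h : entropy (uniformLibrary N B) (bits T) =
      entropy (uniformLibrary N B) fun F (x : T) => F x.1.1 x.1.2 :=
    entropy_congr _ fun F F' => by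
      rw [bits_eq_iff, funext_iff, Subtype.forall]
  rw [h]
  refine (entropy_le_logb_card _ _).trans_eq ?_
  rw [Fintype.card_fun, ZMod.card, Fintype.card_coe, Nat.cast_pow, Real.logb_pow, Nat.cast_ofNat,
    Real.logb_self_eq_one one_lt_two, mul_one]

theorem entropy_uniformLibrary_id : entropy (uniformLibrary N B) id = (N * B : ℕ) := by
  rw [entropy_uniformOfFintype_id, Fintype.card_fun, Fintype.card_fun, ZMod.card, Fintype.card_fin,
    Fintype.card_fin, ← pow_mul, mul_comm, Nat.cast_pow, Real.logb_pow, Nat.cast_ofNat,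
    Real.logb_self_eq_one one_lt_two, mul_one]

theorem entropy_bits (T : Finset (Fin N × Fin B)) :
    entropy (uniformLibrary N B) (bits T) = T.card := by
  refine le_antisymm (entropy_bits_le T) ?_
  have hid : entropy (uniformLibrary N B) id ≤
      entropy (uniformLibrary N B) fun F => (bits T F, bits Tᶜ F) := by
    refine entropy_le_of_determined _ fun F F' h => ?_
    rw [Prod.mk.injEq, ← bits_union_eq_iff, Finset.union_compl, bits_eq_iff] at h
    exact funext₂ fun i b => h (i, b) (Finset.mem_univ _)
  have hcard : (T.card : ℝ) + Tᶜ.card = (N * B : ℕ) := by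
    rw [← Nat.cast_add, Finset.card_add_card_compl, Fintype.card_prod, Fintype.card_fin,
      Fintype.card_fin]
  rw [entropy_uniformLibrary_id] at hid
  linarith [entropy_pair_le (uniformLibrary N B) (bits T) (bits Tᶜ), entropy_bits_le Tᶜ]

variable {α β : Type} [Fintype α] [Fintype β] {p : Library N B → α} {p' : Library N B → β}

/-- Under a uniform library, the bits at the positions in `C` determine `p`. -/
def DeterminedBy (p : Library N B → α) (C : Finset (Fin N × Fin B)) : Prop :=
  condEntropy (uniformLibrary N B) p (bits C) = 0

/-- The uncertainty on file `j` that is left by the packets `p` and `p'` of the two users and by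
the bits at the positions in `C`. -/
def fileResidual (p : Library N B → α) (p' : Library N B → β) (j : Fin N)
    (C : Finset (Fin N × Fin B)) : ℝ :=
  condEntropy (uniformLibrary N B) (bits (row j)) fun F => ((p F, p' F), bits C F)

theorem fileResidual_comm (j : Fin N) (C : Finset (Fin N × Fin B)) :
    fileResidual p p' j C = fileResidual p' p j C :=
  condEntropy_congr _ (fun _ _ _ => Iff.rfl) fun F F' => by
    simp only [Prod.mk.injEq, and_comm (a := p F = _)]

theorem DeterminedBy.entropy_pair_le {C : Finset (Fin N × Fin B)} (hp' : DeterminedBy p' C) :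
    entropy (uniformLibrary N B) (fun F => ((p F, p' F), bits C F)) ≤
      entropy (uniformLibrary N B) fun F => (p F, bits C F) := by
  have h := condEntropy_le_of_determined (uniformLibrary N B) p' (Y := fun F => (p F, bits C F))
    (Z := bits C) fun F F' h => (Prod.mk.inj h).2
  rw [show condEntropy _ p' (bits C) = 0 from hp', condEntropy, sub_nonpos] at h
  refine (entropy_congr _ fun F F' => ?_).trans_le h
  simp only [Prod.mk.injEq]
  tauto

/-- By submodularity, once the bits in `U` are known, file `j` still has to be described by `p`,
up to the bits in `C`, which determine the other packet. -/
theorem DeterminedBy.condEntropy_step (j : Fin N) (U : Finset (Fin N × Fin B))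
    {C : Finset (Fin N × Fin B)} (hp' : DeterminedBy p' C) :
    ((row j \ (U ∪ C)).card : ℝ) +
      condEntropy (uniformLibrary N B) p (bits (U ∪ (C ∪ row j))) ≤
      condEntropy (uniformLibrary N B) p (bits U) + fileResidual p p' j C := by
  rw [← Finset.union_assoc]
  set V := U ∪ C
  have hU : condEntropy (uniformLibrary N B) p (bits V) ≤
      condEntropy (uniformLibrary N B) p (bits U) :=
    condEntropy_le_of_determined _ p fun F F' => bits_eq_of_subset Finset.subset_union_left
  have hC : condEntropy (uniformLibrary N B) (bits (row j)) (fun F => (p F, bits V F)) ≤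
      condEntropy (uniformLibrary N B) (bits (row j)) fun F => (p F, bits C F) :=
    condEntropy_le_of_determined _ _ fun F F' h => by
      rw [Prod.mk.injEq] at h ⊢
      exact ⟨h.1, bits_eq_of_subset Finset.subset_union_right h.2⟩
  have hpair : entropy (uniformLibrary N B) (fun F => (bits (row j) F, p F, bits C F)) ≤
      entropy (uniformLibrary N B) fun F => (bits (row j) F, (p F, p' F), bits C F) :=
    entropy_le_of_determined _ fun F F' h => by
      simp only [Prod.mk.injEq] at h ⊢
      tauto
  have hrow : entropy (uniformLibrary N B) (fun F => (bits (row j) F, p F, bits V F)) =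
      entropy (uniformLibrary N B) fun F => (p F, bits (V ∪ row j) F) :=
    entropy_congr _ fun F F' => by
      simp only [Prod.mk.injEq, bits_union_eq_iff]
      tauto
  have hcard : ((V ∪ row j).card : ℝ) = V.card + (row j \ V).card := by
    rw [Finset.union_comm, ← Finset.card_sdiff_add_card, Nat.cast_add, add_comm]
  have hp := hp'.entropy_pair_le (p := p)
  simp only [fileResidual, condEntropy, entropy_bits] at hU hC ⊢
  linarith

theorem DeterminedBy.card_row_sdiff_le_fileResidual_right {A C : Finset (Fin N × Fin B)}
    (hp : DeterminedBy p A) (hp' : DeterminedBy p' C) (j : Fin N) :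
    ((row j \ (A ∪ C)).card : ℝ) ≤ fileResidual p p' j C := by
  have h := hp'.condEntropy_step (p := p) j A
  rw [show condEntropy _ p (bits A) = 0 from hp, zero_add] at h
  linarith [condEntropy_nonneg (uniformLibrary N B) p (bits (A ∪ (C ∪ row j)))]

theorem DeterminedBy.card_row_sdiff_le_fileResidual_left {A C : Finset (Fin N × Fin B)}
    (hp : DeterminedBy p A) (hp' : DeterminedBy p' C) (j : Fin N) :
    ((row j \ (A ∪ C)).card : ℝ) ≤ fileResidual p p' j A := by
  rw [Finset.union_comm, fileResidual_comm]
  exact hp'.card_row_sdiff_le_fileResidual_right hp j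

theorem sum_card_row_sdiff_add_condEntropy_le {n : ℕ} {f : Fin n → Fin N}
    (hf : Function.Injective f) {C : Fin n → Finset (Fin N × Fin B)}
    (hC : ∀ i, DeterminedBy p' (C i)) :
    ∑ i, ((row (f i) \ (Finset.Iic i).biUnion C).card : ℝ) +
      condEntropy (uniformLibrary N B) p
        (bits (Finset.univ.biUnion fun i => C i ∪ row (f i))) ≤
      entropy (uniformLibrary N B) p + ∑ i, fileResidual p p' (f i) (C i) := by
  induction n with
  | zero => simpa using condEntropy_le_entropy (uniformLibrary N B) p _
  | succ n ih =>
    have hrec := ih (hf.comp (Fin.castSucc_injective n)) fun i => hC i.castSucc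
    have hstep := (hC (Fin.last n)).condEntropy_step (p := p) (f (Fin.last n))
      (Finset.univ.biUnion fun i : Fin n => C i.castSucc ∪ row (f i.castSucc))
    have hIic : ∀ i : Fin n, (Finset.Iic i.castSucc).biUnion C =
        (Finset.Iic i).biUnion fun i => C i.castSucc := fun i => by
      ext x
      simp only [Finset.mem_biUnion, Finset.mem_Iic, Fin.exists_fin_succ',
        Fin.castSucc_le_castSucc_iff, Fin.not_le.2 (Fin.castSucc_lt_last i), false_and, or_false]
    have hlast : (row (f (Fin.last n)) \ ((Finset.univ.biUnion fun i : Fin n =>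
        C i.castSucc ∪ row (f i.castSucc)) ∪ C (Fin.last n)) : Finset (Fin N × Fin B)) =
        row (f (Fin.last n)) \ (Finset.Iic (Fin.last n)).biUnion C := by
      ext x
      simp only [Finset.mem_sdiff, Finset.mem_union, Finset.mem_biUnion, mem_row, Finset.mem_univ,
        true_and, Finset.mem_Iic, Fin.le_last, Fin.exists_fin_succ', not_or, not_exists]
      refine and_congr_right fun hx => and_congr_left' <| forall_congr' fun i =>
        and_iff_left fun hi => ?_
      exact (Fin.castSucc_lt_last i).ne (hf (hi.symm.trans hx))
    have hunion : (Finset.univ.biUnion fun i => C i ∪ row (f i)) =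
        (Finset.univ.biUnion fun i : Fin n => C i.castSucc ∪ row (f i.castSucc)) ∪
          (C (Fin.last n) ∪ row (f (Fin.last n))) := by
      ext x
      simp only [Finset.mem_union, Finset.mem_biUnion, Finset.mem_univ, true_and,
        Fin.exists_fin_succ']
    rw [hlast] at hstep
    rw [hunion, Fin.sum_univ_castSucc, Fin.sum_univ_castSucc]
    simp only [hIic, Function.comp_apply] at hrec ⊢
    linarith

theorem sum_card_row_sdiff_le {n : ℕ} {f : Fin n → Fin N}
    (hf : Function.Injective f) {C : Fin n → Finset (Fin N × Fin B)}
    (hC : ∀ i, DeterminedBy p' (C i)) :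
    ∑ i, ((row (f i) \ (Finset.Iic i).biUnion C).card : ℝ) ≤
      entropy (uniformLibrary N B) p + ∑ i, fileResidual p p' (f i) (C i) :=
  (le_add_of_nonneg_right (condEntropy_nonneg _ _ _)).trans
    (sum_card_row_sdiff_add_condEntropy_le hf hC)

end Bits

section Counting

variable {ι : Type} [DecidableEq ι] (R A₁ A₂ A₃ C₁ C₂ C₃ : Finset ι)

theorem card_sdiff_eq_sum (R A : Finset ι) : (R \ A).card = ∑ x ∈ R, if x ∈ A then 0 else 1 := by
  rw [Finset.sdiff_eq_filter, Finset.card_filter]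
  exact Finset.sum_congr rfl fun x _ => ite_not _ _ _

theorem card_sdiff_two_le :
    (R \ A₁).card + (R \ A₂).card + (R \ C₁).card + (R \ C₂).card ≤
      R.card + (R \ (A₁ ∪ A₂)).card + (R \ (C₁ ∪ C₂)).card +
        ((R \ (A₁ ∪ C₁)).card + (R \ (A₁ ∪ C₂)).card + (R \ (A₂ ∪ C₁)).card +
          (R \ (A₂ ∪ C₂)).card) := by
  simp only [card_sdiff_eq_sum, Finset.card_eq_sum_ones R, ← Finset.sum_add_distrib,
    Finset.mem_union]
  refine Finset.sum_le_sum fun x _ => ?_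
  by_cases x ∈ A₁ <;> by_cases x ∈ A₂ <;> by_cases x ∈ C₁ <;> by_cases x ∈ C₂ <;> simp [*]

theorem card_sdiff_three_le :
    (R \ A₁).card + (R \ A₂).card + (R \ A₃).card + (R \ C₁).card + (R \ C₂).card +
        (R \ C₃).card ≤
      2 * R.card + (R \ (A₁ ∪ (A₂ ∪ A₃))).card + (R \ (C₁ ∪ (C₂ ∪ C₃))).card +
        ((R \ (A₁ ∪ C₁)).card + (R \ (A₁ ∪ C₂)).card + (R \ (A₂ ∪ C₁)).card +
          (R \ (A₁ ∪ C₃)).card + (R \ (A₂ ∪ C₃)).card + (R \ (A₃ ∪ C₃)).card +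
          (R \ (A₃ ∪ C₁)).card + (R \ (A₃ ∪ C₂)).card) := by
  simp only [card_sdiff_eq_sum, Finset.card_eq_sum_ones R, ← Finset.sum_add_distrib,
    Finset.mem_union, Finset.mul_sum]
  refine Finset.sum_le_sum fun x _ => ?_
  by_cases x ∈ A₁ <;> by_cases x ∈ A₂ <;> by_cases x ∈ A₃ <;> by_cases x ∈ C₁ <;>
    by_cases x ∈ C₂ <;> by_cases x ∈ C₃ <;> simp [*]

end Counting

section PacketEntropy

variable {N B : ℕ} {α β : Type} [Fintype α] [Fintype β] {p : Library N B → α}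
  {p' : Library N B → β} {A₁ A₂ A₃ C₁ C₂ C₃ : Finset (Fin N × Fin B)}

theorem card_row_sdiff_two_le (hA₁ : DeterminedBy p A₁) (hA₂ : DeterminedBy p A₂)
    (hC₁ : DeterminedBy p' C₁) (hC₂ : DeterminedBy p' C₂) (f : Fin N) :
    ((row f \ A₁).card : ℝ) + (row f \ A₂).card + (row f \ C₁).card + (row f \ C₂).card ≤
      B + (row f \ (A₁ ∪ A₂)).card + (row f \ (C₁ ∪ C₂)).card + (row f \ (A₁ ∪ C₁)).card +
        fileResidual p p' f A₂ + 2 * fileResidual p p' f C₂ := by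
  have hcount : ((_ : ℕ) : ℝ) ≤ _ := Nat.cast_le.2 (card_sdiff_two_le (row f) A₁ A₂ C₁ C₂)
  push_cast [card_row] at hcount
  linarith [hA₁.card_row_sdiff_le_fileResidual_right hC₂ f,
    hA₂.card_row_sdiff_le_fileResidual_right hC₂ f, hA₂.card_row_sdiff_le_fileResidual_left hC₁ f]

theorem card_row_sdiff_three_le (hA₁ : DeterminedBy p A₁) (hA₂ : DeterminedBy p A₂)
    (hA₃ : DeterminedBy p A₃) (hC₁ : DeterminedBy p' C₁) (hC₂ : DeterminedBy p' C₂)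
    (hC₃ : DeterminedBy p' C₃) (f : Fin N) :
    ((row f \ A₁).card : ℝ) + (row f \ A₂).card + (row f \ A₃).card + (row f \ C₁).card +
        (row f \ C₂).card + (row f \ C₃).card ≤
      2 * B + (row f \ (A₁ ∪ (A₂ ∪ A₃))).card + (row f \ (C₁ ∪ (C₂ ∪ C₃))).card +
        (row f \ (A₁ ∪ C₁)).card + (row f \ (A₁ ∪ C₂)).card + (row f \ (A₂ ∪ C₁)).card +
        2 * fileResidual p p' f A₃ + 3 * fileResidual p p' f C₃ := by
  have hcount : ((_ : ℕ) : ℝ) ≤ _ :=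
    Nat.cast_le.2 (card_sdiff_three_le (row f) A₁ A₂ A₃ C₁ C₂ C₃)
  push_cast [card_row] at hcount
  linarith [hA₁.card_row_sdiff_le_fileResidual_right hC₃ f,
    hA₂.card_row_sdiff_le_fileResidual_right hC₃ f, hA₃.card_row_sdiff_le_fileResidual_right hC₃ f,
    hA₃.card_row_sdiff_le_fileResidual_left hC₁ f, hA₃.card_row_sdiff_le_fileResidual_left hC₂ f]

theorem card_row_sdiff_le_entropy_one (hC₁ : DeterminedBy p' C₁) (f : Fin N) :
    ((row f \ C₁).card : ℝ) ≤ entropy (uniformLibrary N B) p + fileResidual p p' f C₁ := by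
  simpa [show Finset.Iic (0 : Fin 1) = {0} from rfl] using
    sum_card_row_sdiff_le (p := p) (f := ![f]) (C := ![C₁]) (Function.injective_of_subsingleton _)
      (by simpa using hC₁)

theorem card_row_sdiff_le_entropy_two (hC₁ : DeterminedBy p' C₁) (hC₂ : DeterminedBy p' C₂)
    {f₁ f₂ : Fin N} (h₁₂ : f₁ ≠ f₂) :
    ((row f₁ \ C₁).card : ℝ) + (row f₂ \ (C₁ ∪ C₂)).card ≤
      entropy (uniformLibrary N B) p + (fileResidual p p' f₁ C₁ + fileResidual p p' f₂ C₂) := by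
  have h := sum_card_row_sdiff_le (p := p) (p' := p') (f := ![f₁, f₂]) (C := ![C₁, C₂])
    (by simpa [Function.Injective, Fin.forall_fin_two, eq_comm] using h₁₂)
    (by simpa [Fin.forall_fin_two] using ⟨hC₁, hC₂⟩)
  simpa [Fin.sum_univ_two, show Finset.Iic (0 : Fin 2) = {0} from rfl,
    show Finset.Iic (1 : Fin 2) = {0, 1} from rfl] using h

theorem card_row_sdiff_le_entropy_three (hC₁ : DeterminedBy p' C₁) (hC₂ : DeterminedBy p' C₂)
    (hC₃ : DeterminedBy p' C₃) {f₁ f₂ f₃ : Fin N} (h₁₂ : f₁ ≠ f₂) (h₁₃ : f₁ ≠ f₃)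
    (h₂₃ : f₂ ≠ f₃) :
    ((row f₁ \ C₁).card : ℝ) + (row f₂ \ (C₁ ∪ C₂)).card + (row f₃ \ (C₁ ∪ (C₂ ∪ C₃))).card ≤
      entropy (uniformLibrary N B) p +
        (fileResidual p p' f₁ C₁ + fileResidual p p' f₂ C₂ + fileResidual p p' f₃ C₃) := by
  have h := sum_card_row_sdiff_le (p := p) (p' := p') (f := ![f₁, f₂, f₃]) (C := ![C₁, C₂, C₃])
    (by simp [Function.Injective, Fin.forall_fin_succ, h₁₂, h₁₃, h₂₃, h₁₂.symm, h₁₃.symm,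
      h₂₃.symm])
    (by simpa [Fin.forall_fin_succ] using ⟨hC₁, hC₂, hC₃⟩)
  simpa [Fin.sum_univ_three, show Finset.Iic (0 : Fin 3) = {0} from rfl,
    show Finset.Iic (1 : Fin 3) = {0, 1} from rfl,
    show Finset.Iic (2 : Fin 3) = {0, 1, 2} from rfl] using h

theorem le_entropy_add_entropy_of_one (hA₁ : DeterminedBy p A₁) (hC₁ : DeterminedBy p' C₁)
    (f : Fin N) :
    ((row f \ A₁).card : ℝ) + (row f \ C₁).card ≤
      entropy (uniformLibrary N B) p + entropy (uniformLibrary N B) p' +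
        (fileResidual p p' f A₁ + fileResidual p p' f C₁) := by
  have hA := card_row_sdiff_le_entropy_one (p := p') hA₁ f
  rw [fileResidual_comm] at hA
  linarith [card_row_sdiff_le_entropy_one (p := p) hC₁ f]

theorem le_entropy_add_entropy_of_two (hA₁ : DeterminedBy p A₁) (hA₂ : DeterminedBy p A₂)
    (hC₁ : DeterminedBy p' C₁) (hC₂ : DeterminedBy p' C₂) {f₁ f₂ : Fin N} (h₁₂ : f₁ ≠ f₂) :
    ((row f₁ \ A₁).card : ℝ) + (row f₁ \ C₁).card +
      ((row f₂ \ A₁).card + (row f₂ \ A₂).card + (row f₂ \ C₁).card + (row f₂ \ C₂).card) ≤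
      entropy (uniformLibrary N B) p + entropy (uniformLibrary N B) p' + B +
        (fileResidual p p' f₁ A₁ + fileResidual p p' f₁ C₁ + (row f₂ \ (A₁ ∪ C₁)).card) +
        2 * fileResidual p p' f₂ A₂ + 3 * fileResidual p p' f₂ C₂ := by
  have hA := card_row_sdiff_le_entropy_two (p := p') hA₁ hA₂ h₁₂
  simp only [fileResidual_comm (p := p') (p' := p)] at hA
  linarith [card_row_sdiff_le_entropy_two (p := p) hC₁ hC₂ h₁₂,
    card_row_sdiff_two_le hA₁ hA₂ hC₁ hC₂ f₂]

theorem le_entropy_add_entropy_of_three (hA₁ : DeterminedBy p A₁) (hA₂ : DeterminedBy p A₂)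
    (hA₃ : DeterminedBy p A₃) (hC₁ : DeterminedBy p' C₁) (hC₂ : DeterminedBy p' C₂)
    (hC₃ : DeterminedBy p' C₃) {f₁ f₂ f₃ : Fin N} (h₁₂ : f₁ ≠ f₂) (h₁₃ : f₁ ≠ f₃)
    (h₂₃ : f₂ ≠ f₃) :
    ((row f₁ \ A₁).card : ℝ) + (row f₁ \ C₁).card +
      ((row f₂ \ A₁).card + (row f₂ \ A₂).card + (row f₂ \ C₁).card + (row f₂ \ C₂).card) +
      ((row f₃ \ A₁).card + (row f₃ \ A₂).card + (row f₃ \ A₃).card +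
        (row f₃ \ C₁).card + (row f₃ \ C₂).card + (row f₃ \ C₃).card) ≤
      entropy (uniformLibrary N B) p + entropy (uniformLibrary N B) p' + 3 * B +
        (fileResidual p p' f₁ A₁ + fileResidual p p' f₁ C₁ + (row f₂ \ (A₁ ∪ C₁)).card +
          (row f₃ \ (A₁ ∪ C₁)).card) +
        (2 * fileResidual p p' f₂ A₂ + (row f₃ \ (A₂ ∪ C₁)).card) +
        (3 * fileResidual p p' f₂ C₂ + (row f₃ \ (A₁ ∪ C₂)).card) +
        3 * fileResidual p p' f₃ A₃ + 4 * fileResidual p p' f₃ C₃ := by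
  have hA := card_row_sdiff_le_entropy_three (p := p') hA₁ hA₂ hA₃ h₁₂ h₁₃ h₂₃
  simp only [fileResidual_comm (p := p') (p' := p)] at hA
  linarith [card_row_sdiff_le_entropy_three (p := p) hC₁ hC₂ hC₃ h₁₂ h₁₃ h₂₃,
    card_row_sdiff_two_le hA₁ hA₂ hC₁ hC₂ f₂, card_row_sdiff_three_le hA₁ hA₂ hA₃ hC₁ hC₂ hC₃ f₃]

end PacketEntropy

namespace CachingScheme

section Law

variable {K N B : ℕ} (s : CachingScheme K N B) (demandLaw : PMF (Demands K N))

theorem law_eq_prodLaw :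
    s.law demandLaw = prodLaw (uniformLibrary N B) (prodLaw demandLaw s.seedLaw) := by
  simp only [law, prodLaw, PMF.map_bind, PMF.map_comp]
  rfl

theorem expect_entropy_le_law {α : Type} [Fintype α] (X : s.Sample → α) :
    expect demandLaw (fun d => expect s.seedLaw fun w =>
      entropy (uniformLibrary N B) fun F => X (F, d, w)) ≤ entropy (s.law demandLaw) X := by
  rw [law_eq_prodLaw, ← expect_prodLaw demandLaw s.seedLaw fun ω =>
    entropy (uniformLibrary N B) fun F => X (F, ω)]
  exact expect_entropy_le _ _ X

theorem expect_condEntropy_le_law {α β : Type} [Fintype α] [Fintype β] (X : s.Sample → α)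
    (Y : s.Sample → β) :
    expect demandLaw (fun d => expect s.seedLaw fun w =>
      condEntropy (uniformLibrary N B) (fun F => X (F, d, w)) fun F => Y (F, d, w)) ≤
      condEntropy (s.law demandLaw) X Y := by
  rw [law_eq_prodLaw, ← expect_prodLaw demandLaw s.seedLaw fun ω =>
    condEntropy (uniformLibrary N B) (fun F => X (F, ω)) fun F => Y (F, ω)]
  exact expect_condEntropy_le _ _ X Y

theorem law_map_rotate :
    (s.law demandLaw).map (fun ω => (ω.2.1, ω.1, ω.2.2)) =
      prodLaw demandLaw (prodLaw (uniformLibrary N B) s.seedLaw) := by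
  simp only [law, prodLaw, PMF.map_bind, PMF.map_comp]
  exact PMF.bind_comm _ _ _

variable {s demandLaw}

theorem privacy_iff {k : Fin K} :
    condMutualInfo (s.law demandLaw) s.demands (fun ω => (s.signals ω, s.cache k ω))
        (s.demand k) = 0 ↔
      ∀ d ∈ demandLaw.support, ∀ d' ∈ demandLaw.support, d k = d' k →
        (prodLaw (uniformLibrary N B) s.seedLaw).map
            (fun ω => (s.signals (ω.1, d, ω.2), s.cache k (ω.1, d, ω.2))) =
          (prodLaw (uniformLibrary N B) s.seedLaw).map
            (fun ω => (s.signals (ω.1, d', ω.2), s.cache k (ω.1, d', ω.2))) := by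
  rw [← condMutualInfo_prodLaw_eq_zero_iff demandLaw (prodLaw (uniformLibrary N B) s.seedLaw)
    (fun d => d k) fun ω => (s.signals (ω.2.1, ω.1, ω.2.2), s.cache k (ω.2.1, ω.1, ω.2.2)),
    ← law_map_rotate]
  simp only [condMutualInfo, condEntropy, entropy, PMF.map_comp]
  rfl

/-- The joint law of the metadata that the server sends and of the metadata of the cache of user
`k` depends on the demands only through the demand of user `k`. -/
def HasPrivateMetadata (s : CachingScheme K N B) : Prop :=
  ∀ (k : Fin K) (d d' : Demands K N), d k = d' k →
    s.seedLaw.map (fun w => (s.txMeta w d, s.cacheMeta w k)) =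
      s.seedLaw.map (fun w => (s.txMeta w d', s.cacheMeta w k))

theorem hasPrivateMetadata_of_privacy (hfull : ∀ d, demandLaw d ≠ 0)
    (h : ∀ k, condMutualInfo (s.law demandLaw) s.demands
      (fun ω => (s.signals ω, s.cache k ω)) (s.demand k) = 0) : s.HasPrivateMetadata := by
  intro k d d' hd
  have hsnd : (prodLaw (uniformLibrary N B) s.seedLaw).map Prod.snd = s.seedLaw := by
    simp only [prodLaw, PMF.map_bind, PMF.map_comp]
    exact (congrArg _ (funext fun _ => s.seedLaw.map_id)).trans (PMF.bind_const _ _)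
  have hmap := congrArg (PMF.map fun x : (Fin K → s.TxMeta × s.Payload) ×
    s.CacheMeta × s.Content => ((fun k => (x.1 k).1), x.2.1))
    (privacy_iff.1 (h k) d (hfull d) d' (hfull d') hd)
  rw [PMF.map_comp, PMF.map_comp] at hmap
  rw [← hsnd, PMF.map_comp, PMF.map_comp]
  exact hmap

/-- Under the metadata `m`, the content of a cache amounts to the bits at the positions `S m`. -/
def CachesBits (s : CachingScheme K N B) (k : Fin K)
    (S : s.CacheMeta → Finset (Fin N × Fin B)) : Prop :=
  ∀ m F F', s.content k m F = s.content k m F' ↔ bits (S m) F = bits (S m) F'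

theorem IsUncoded.exists_cachesBits (h : s.IsUncoded) (k : Fin K) : ∃ S, s.CachesBits k S := by
  classical
  choose S hS using h k
  refine ⟨fun m => (S m).toFinset, fun m F F' => ?_⟩
  simp only [hS, bits_eq_iff, Set.mem_toFinset]

namespace CachesBits

variable {k : Fin K} {S : s.CacheMeta → Finset (Fin N × Fin B)}

theorem cache_eq_iff (hS : s.CachesBits k S) (d : Demands K N) (w : s.Seed)
    (F F' : Library N B) :
    s.cache k (F, d, w) = s.cache k (F', d, w) ↔
      bits (S (s.cacheMeta w k)) F = bits (S (s.cacheMeta w k)) F' := by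
  rw [cache, cache, Prod.mk.injEq, eq_self, true_and]
  exact hS _ F F'

theorem expect_card_le (hS : s.CachesBits k S) :
    expect s.seedLaw (fun w => ((S (s.cacheMeta w k)).card : ℝ)) ≤
      entropy (s.law demandLaw) (s.cache k) := by
  refine le_trans (le_of_eq ?_) (s.expect_entropy_le_law demandLaw (s.cache k))
  rw [← expect_const demandLaw (expect _ _)]
  refine expect_congr fun d _ => expect_congr fun w _ => ?_
  rw [← entropy_bits]
  exact entropy_congr _ fun F F' => hS.cache_eq_iff d w F F'

theorem determinedBy_payload (hS : s.CachesBits k S)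
    (h : condEntropy (s.law demandLaw) (s.signal k)
      (fun ω => (s.packetMeta k ω, s.cache k ω)) = 0)
    {d : Demands K N} (hd : d ∈ demandLaw.support) {w : s.Seed} (hw : w ∈ s.seedLaw.support) :
    DeterminedBy (s.payload k (s.txMeta w d k)) (S (s.cacheMeta w k)) := by
  have hnonneg : ∀ d w, 0 ≤ condEntropy (uniformLibrary N B) (fun F => s.signal k (F, d, w))
    fun F => (s.packetMeta k (F, d, w), s.cache k (F, d, w)) := fun _ _ => condEntropy_nonneg _ _ _
  have hzero := eq_zero_of_expect_eq_zero (hnonneg d) (eq_zero_of_expect_eq_zero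
    (fun d => expect_nonneg _ (hnonneg d)) (((s.expect_condEntropy_le_law demandLaw _ _).trans_eq
      h).antisymm (expect_nonneg _ fun d => expect_nonneg _ (hnonneg d))) hd) hw
  rw [DeterminedBy, ← hzero]
  refine condEntropy_congr _ (fun F F' _ => ?_) fun F F' => ?_
  · simp only [signal, packetMeta, Prod.mk.injEq, true_and]
  · simp only [packetMeta, hS.cache_eq_iff d w F F', Prod.mk.injEq, true_and]

end CachesBits

end Law

section TwoUsers

variable {N B : ℕ} {s : CachingScheme 2 N B} {demandLaw : PMF (Demands 2 N)}

/-- The uncertainty on file `j` that is left, under the metadata `q` from the server, by the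
packets of both users and by the bits at the positions in `C`. -/
def residual (s : CachingScheme 2 N B) (q : Fin 2 → s.TxMeta) (j : Fin N)
    (C : Finset (Fin N × Fin B)) : ℝ :=
  fileResidual (s.payload 0 (q 0)) (s.payload 1 (q 1)) j C

/-- The entropy of the packets of both users under the metadata `q` from the server. -/
def payloadEntropy (s : CachingScheme 2 N B) (q : Fin 2 → s.TxMeta) : ℝ :=
  entropy (uniformLibrary N B) (s.payload 0 (q 0)) +
    entropy (uniformLibrary N B) (s.payload 1 (q 1))

theorem residual_nonneg (q : Fin 2 → s.TxMeta) (j : Fin N) (C : Finset (Fin N × Fin B)) :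
    0 ≤ s.residual q j C :=
  condEntropy_nonneg _ _ _

theorem CachesBits.mul_expect_residual_le {k : Fin 2} {S : s.CacheMeta → Finset (Fin N × Fin B)}
    (hS : s.CachesBits k S) (d : Demands 2 N) :
    (demandLaw d).toReal *
        expect s.seedLaw (fun w => s.residual (s.txMeta w d) (d k) (S (s.cacheMeta w k))) ≤
      condEntropy (s.law demandLaw) (s.demandedFile k)
        (fun ω => (s.signals ω, s.cache k ω, s.demand k ω)) := by
  refine le_trans (le_of_eq ?_) ((mul_le_expect demandLaw (fun d => expect_nonneg _ fun w =>
    condEntropy_nonneg _ _ _) d).trans (s.expect_condEntropy_le_law demandLaw _ _))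
  congr 1
  refine expect_congr fun w _ => condEntropy_congr _ (fun F F' _ => bits_row_eq_iff) fun F F' => ?_
  simp only [Prod.mk.injEq, hS.cache_eq_iff d w F F', signals, signal, packetMeta, demand,
    funext_iff, Fin.forall_fin_two, true_and, and_true]

theorem expect_payloadEntropy_eq (hpriv : s.HasPrivateMetadata) (d d' : Demands 2 N) :
    expect s.seedLaw (fun w => s.payloadEntropy (s.txMeta w d)) =
      expect s.seedLaw fun w => s.payloadEntropy (s.txMeta w d') := by
  have hstep : ∀ (k : Fin 2) (d d' : Demands 2 N), d k = d' k →
      expect s.seedLaw (fun w => s.payloadEntropy (s.txMeta w d)) =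
        expect s.seedLaw fun w => s.payloadEntropy (s.txMeta w d') := fun k d d' h =>
    expect_congr_of_map_eq (hpriv k d d' h) fun t => s.payloadEntropy t.1
  exact (hstep 0 d ![d 0, d' 1] rfl).trans (hstep 1 _ d' rfl)

theorem expect_payloadEntropy_le (hpriv : s.HasPrivateMetadata) (d : Demands 2 N) :
    expect s.seedLaw (fun w => s.payloadEntropy (s.txMeta w d)) ≤
      ∑ k, entropy (s.law demandLaw) (s.signal k) := by
  rw [← expect_const demandLaw (expect _ _), Fin.sum_univ_two]
  refine le_trans (le_of_eq ?_) (add_le_add (s.expect_entropy_le_law demandLaw (s.signal 0))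
    (s.expect_entropy_le_law demandLaw (s.signal 1)))
  rw [← expect_add]
  refine expect_congr fun d' _ => ?_
  rw [expect_payloadEntropy_eq hpriv d d', ← expect_add]
  refine expect_congr fun w _ => ?_
  rw [payloadEntropy]
  congr 1 <;> exact entropy_congr _ fun F F' => by
    simp only [signal, packetMeta, Prod.mk.injEq, true_and]

end TwoUsers

end CachingScheme

section Resample

variable {Θ α : Type} [Fintype Θ] [Fintype α]

/-- Resampling by a function rather than by a conditional law: among the samples that are compatible
with a value, it picks one of least cost, so that no cost increases on average. -/
theorem exists_resample {v : PMF Θ} {X X' : Θ → α} (h : v.map X = v.map X') (φ : α → Θ → ℝ) :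
    ∃ σ : Θ → Θ, (∀ w ∈ v.support, σ w ∈ v.support ∧ X (σ w) = X' w) ∧
      expect v (fun w => φ (X' w) (σ w)) ≤ expect v fun w => φ (X w) w := by
  classical
  have hmin : ∀ x, ∃ w₀, ∀ w ∈ v.support, X w = x →
      w₀ ∈ v.support ∧ X w₀ = x ∧ φ x w₀ ≤ φ x w := fun x => by
    rcases (Finset.univ.filter fun w => w ∈ v.support ∧ X w = x).eq_empty_or_nonempty with hx | hx
    · obtain ⟨w₁, _⟩ := v.support_nonempty
      exact ⟨w₁, fun w hw hwx => absurd ⟨hw, hwx⟩ (Finset.filter_eq_empty_iff.1 hx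
        (Finset.mem_univ w))⟩
    · obtain ⟨w₀, h₀, hle⟩ := Finset.exists_min_image _ (φ x) hx
      simp only [Finset.mem_filter, Finset.mem_univ, true_and] at h₀ hle
      exact ⟨w₀, fun w hw hwx => ⟨h₀.1, h₀.2, hle w ⟨hw, hwx⟩⟩⟩
  choose τ hτ using hmin
  refine ⟨fun w => τ (X' w), fun w hw => ?_, ?_⟩
  · obtain ⟨w', hw', hX⟩ := (PMF.mem_support_map_iff X v (X' w)).1
      (h ▸ (PMF.mem_support_map_iff X' v _).2 ⟨w, hw, rfl⟩)
    exact ⟨(hτ _ w' hw' hX).1, (hτ _ w' hw' hX).2.1⟩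
  · rw [← expect_congr_of_map_eq h fun x => φ x (τ x)]
    exact expect_mono fun w hw => (hτ (X w) w hw rfl).2.2

end Resample

namespace CachingScheme

variable {N B : ℕ} {s : CachingScheme 2 N B} {S : Fin 2 → s.CacheMeta → Finset (Fin N × Fin B)}
  {η L : ℝ}

/-- What the constraints on a scheme for two users with uncoded placement amount to on the level of
the metadata: under metadata `m`, user `k` caches the bits at the positions `S k m`. -/
structure IsPrivateUncoded (s : CachingScheme 2 N B)
    (S : Fin 2 → s.CacheMeta → Finset (Fin N × Fin B)) (η L : ℝ) : Prop where
  encoding : ∀ (k : Fin 2) (d : Demands 2 N), ∀ w ∈ s.seedLaw.support,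
    DeterminedBy (s.payload k (s.txMeta w d k)) (S k (s.cacheMeta w k))
  decoding : ∀ (k : Fin 2) (d : Demands 2 N),
    expect s.seedLaw (fun w => s.residual (s.txMeta w d) (d k) (S k (s.cacheMeta w k))) ≤ η
  privacy : s.HasPrivateMetadata
  load : ∀ d : Demands 2 N, expect s.seedLaw (fun w => s.payloadEntropy (s.txMeta w d)) ≤ L

variable (s S) in
/-- The average number of bits of file `j` that user `k` does not cache. -/
def uncached (k : Fin 2) (j : Fin N) : ℝ :=
  expect s.seedLaw fun w => ((row j \ S k (s.cacheMeta w k)).card : ℝ)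

namespace IsPrivateUncoded

variable (h : s.IsPrivateUncoded S η L)
include h

/-- By privacy towards user `k'`, the metadata sent for the demands `d'` are compatible with a
cache of user `k` that arises for the demands `d`. -/
theorem exists_cacheMeta (k k' : Fin 2) {d d' : Demands 2 N} (hd : d k' = d' k')
    (φ : (Fin 2 → s.TxMeta) → s.CacheMeta → s.CacheMeta → ℝ) :
    ∃ c : s.Seed → s.CacheMeta, (∀ w ∈ s.seedLaw.support,
        DeterminedBy (s.payload k (s.txMeta w d' k)) (S k (c w))) ∧
      expect s.seedLaw (fun w => φ (s.txMeta w d') (s.cacheMeta w k') (c w)) ≤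
        expect s.seedLaw fun w => φ (s.txMeta w d) (s.cacheMeta w k') (s.cacheMeta w k) := by
  obtain ⟨σ, hσ, hcost⟩ := exists_resample (h.privacy k' d d' hd)
    fun x w => φ x.1 x.2 (s.cacheMeta w k)
  refine ⟨fun w => s.cacheMeta (σ w) k, fun w hw => ?_, hcost⟩
  rw [← (Prod.mk.inj (hσ w hw).2).1]
  exact h.encoding k d (σ w) (hσ w hw).1

theorem expect_card_row_sdiff_le (j : Fin N) :
    expect s.seedLaw (fun w =>
      ((row j \ (S 0 (s.cacheMeta w 0) ∪ S 1 (s.cacheMeta w 1))).card : ℝ)) ≤ η :=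
  (expect_mono fun w hw => (h.encoding 0 ![j, j] w hw).card_row_sdiff_le_fileResidual_right
    (h.encoding 1 ![j, j] w hw) j).trans (h.decoding 1 ![j, j])

theorem uncached_one_le (f : Fin N) :
    uncached s S 0 f + uncached s S 1 f ≤ L + 2 * η := by
  have key := expect_mono fun w hw => le_entropy_add_entropy_of_one
    (h.encoding 0 ![f, f] w hw) (h.encoding 1 ![f, f] w hw) f
  have hload := h.load ![f, f]
  have hdec₀ := h.decoding 0 ![f, f]
  have hdec₁ := h.decoding 1 ![f, f]
  simp only [payloadEntropy, residual, uncached, Matrix.cons_val_zero, Matrix.cons_val_one,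
    expect_add] at *
  linarith

theorem uncached_two_le {f₁ f₂ : Fin N} (h₁₂ : f₁ ≠ f₂) :
    uncached s S 0 f₁ + uncached s S 1 f₁ + 2 * (uncached s S 0 f₂ + uncached s S 1 f₂) ≤
      L + B + 8 * η := by
  obtain ⟨a₂, hA₂, hcostA₂⟩ := h.exists_cacheMeta 0 1 (d := ![f₂, f₁]) (d' := ![f₁, f₁]) rfl
    fun q _ a => 2 * s.residual q f₂ (S 0 a) - ((row f₂ \ S 0 a).card : ℝ)
  obtain ⟨c₂, hC₂, hcostC₂⟩ := h.exists_cacheMeta 1 0 (d := ![f₁, f₂]) (d' := ![f₁, f₁]) rfl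
    fun q _ c => 3 * s.residual q f₂ (S 1 c) - ((row f₂ \ S 1 c).card : ℝ)
  have key := expect_mono fun w hw => le_entropy_add_entropy_of_two
    (h.encoding 0 ![f₁, f₁] w hw) (hA₂ w hw) (h.encoding 1 ![f₁, f₁] w hw) (hC₂ w hw) h₁₂
  have hload := h.load ![f₁, f₁]
  have hdec₁₀ := h.decoding 0 ![f₁, f₁]
  have hdec₁₁ := h.decoding 1 ![f₁, f₁]
  have hdec₂₀ := h.decoding 0 ![f₂, f₁]
  have hdec₂₁ := h.decoding 1 ![f₁, f₂]
  have hcover := h.expect_card_row_sdiff_le f₂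
  simp only [payloadEntropy, residual, uncached, Matrix.cons_val_zero, Matrix.cons_val_one,
    expect_add, expect_sub, expect_const_mul, expect_const] at *
  linarith

theorem uncached_three_le {f₁ f₂ f₃ : Fin N} (h₁₂ : f₁ ≠ f₂) (h₁₃ : f₁ ≠ f₃) (h₂₃ : f₂ ≠ f₃) :
    uncached s S 0 f₁ + uncached s S 1 f₁ + 2 * (uncached s S 0 f₂ + uncached s S 1 f₂) +
      3 * (uncached s S 0 f₃ + uncached s S 1 f₃) ≤ L + 3 * B + 18 * η := by
  obtain ⟨a₂, hA₂, hcostA₂⟩ := h.exists_cacheMeta 0 1 (d := ![f₂, f₁]) (d' := ![f₁, f₁]) rfl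
    fun q c a => 2 * s.residual q f₂ (S 0 a) + ((row f₃ \ (S 0 a ∪ S 1 c)).card : ℝ) -
      ((row f₂ \ S 0 a).card : ℝ) - ((row f₃ \ S 0 a).card : ℝ)
  obtain ⟨c₂, hC₂, hcostC₂⟩ := h.exists_cacheMeta 1 0 (d := ![f₁, f₂]) (d' := ![f₁, f₁]) rfl
    fun q a c => 3 * s.residual q f₂ (S 1 c) + ((row f₃ \ (S 0 a ∪ S 1 c)).card : ℝ) -
      ((row f₂ \ S 1 c).card : ℝ) - ((row f₃ \ S 1 c).card : ℝ)
  obtain ⟨a₃, hA₃, hcostA₃⟩ := h.exists_cacheMeta 0 1 (d := ![f₃, f₁]) (d' := ![f₁, f₁]) rfl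
    fun q _ a => 3 * s.residual q f₃ (S 0 a) - ((row f₃ \ S 0 a).card : ℝ)
  obtain ⟨c₃, hC₃, hcostC₃⟩ := h.exists_cacheMeta 1 0 (d := ![f₁, f₃]) (d' := ![f₁, f₁]) rfl
    fun q _ c => 4 * s.residual q f₃ (S 1 c) - ((row f₃ \ S 1 c).card : ℝ)
  have key := expect_mono fun w hw => le_entropy_add_entropy_of_three
    (h.encoding 0 ![f₁, f₁] w hw) (hA₂ w hw) (hA₃ w hw)
    (h.encoding 1 ![f₁, f₁] w hw) (hC₂ w hw) (hC₃ w hw) h₁₂ h₁₃ h₂₃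
  have hload := h.load ![f₁, f₁]
  have hdec₁₀ := h.decoding 0 ![f₁, f₁]
  have hdec₁₁ := h.decoding 1 ![f₁, f₁]
  have hdec₂₀ := h.decoding 0 ![f₂, f₁]
  have hdec₂₁ := h.decoding 1 ![f₁, f₂]
  have hdec₃₀ := h.decoding 0 ![f₃, f₁]
  have hdec₃₁ := h.decoding 1 ![f₁, f₃]
  have hcover₂ := h.expect_card_row_sdiff_le f₂
  have hcover₃ := h.expect_card_row_sdiff_le f₃
  simp only [payloadEntropy, residual, uncached, Matrix.cons_val_zero, Matrix.cons_val_one,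
    expect_add, expect_sub, expect_const_mul, expect_const] at *
  linarith

end IsPrivateUncoded

theorem sum_uncached (k : Fin 2) :
    ∑ j, uncached s S k j =
      N * B - expect s.seedLaw (fun w => ((S k (s.cacheMeta w k)).card : ℝ)) := by
  simp only [uncached, ← expect_sum, sum_card_row_sdiff, expect_sub, expect_const]

theorem isPrivateUncoded {demandLaw : PMF (Demands 2 N)} (hfull : ∀ d, demandLaw d ≠ 0)
    {M R ε : ℝ} (hv : s.IsValid demandLaw M R ε) (hS : ∀ k, s.CachesBits k (S k)) :
    s.IsPrivateUncoded S (B * ε * ∑ d, ((demandLaw d).toReal)⁻¹) (B * (R + ε)) := by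
  have hpriv := hasPrivateMetadata_of_privacy hfull hv.privacy
  refine ⟨fun k d w hw => (hS k).determinedBy_payload (hv.encoding k) (hfull d) hw,
    fun k d => ?_, hpriv, fun d => (expect_payloadEntropy_le hpriv d).trans hv.load⟩
  have hd : 0 < (demandLaw d).toReal := toReal_pos_of_mem_support (hfull d)
  have hle := ((hS k).mul_expect_residual_le d).trans (hv.decoding k)
  have hslack : 0 ≤ B * ε :=
    (mul_nonneg hd.le (expect_nonneg _ fun w => residual_nonneg _ _ _)).trans hle
  rw [mul_comm, ← le_div_iff₀ hd, div_eq_mul_inv] at hle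
  exact hle.trans (mul_le_mul_of_nonneg_left (Finset.single_le_sum
    (f := fun d => ((demandLaw d).toReal)⁻¹) (fun d _ => inv_nonneg.2 ENNReal.toReal_nonneg)
    (Finset.mem_univ d)) hslack)

theorem le_sum_uncached {demandLaw : PMF (Demands 2 N)} {M R ε : ℝ}
    (hv : s.IsValid demandLaw M R ε) (hS : ∀ k, s.CachesBits k (S k)) :
    2 * (B * (N - M - ε)) ≤ ∑ j, (uncached s S 0 j + uncached s S 1 j) := by
  rw [Finset.sum_add_distrib, sum_uncached, sum_uncached]
  linarith [((hS 0).expect_card_le (demandLaw := demandLaw)).trans (hv.memory 0),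
    ((hS 1).expect_card_le (demandLaw := demandLaw)).trans (hv.memory 1)]

end CachingScheme

section Converse

variable {N : ℕ} {demandLaw : PMF (Demands 2 N)} {M R : ℝ}

theorem le_of_achievable_uncoded (hfull : ∀ d, demandLaw d ≠ 0) {a b c : ℝ} (ha : 0 ≤ a)
    (h : Achievable (UncodedPlacement 2 N) demandLaw M R)
    (hbound : ∀ (B : ℕ) (s : CachingScheme 2 N B)
      (S : Fin 2 → s.CacheMeta → Finset (Fin N × Fin B)) (η L : ℝ), s.IsPrivateUncoded S η L →
      a * ∑ j, (s.uncached S 0 j + s.uncached S 1 j) ≤ N * (L + b * B + c * η)) :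
    2 * a * (N - M) ≤ N * (R + b) := by
  obtain ⟨ε, _, hlim, hev⟩ := h
  set e := ∑ d, ((demandLaw d).toReal)⁻¹
  have hlim' : Tendsto (fun B => N * (R + b) + (N * (1 + c * e) + 2 * a) * ε B) atTop
      (𝓝 (N * (R + b))) := by
    simpa only [mul_zero, add_zero] using
      (hlim.const_mul (N * (1 + c * e) + 2 * a)).const_add ((N : ℝ) * (R + b))
  refine ge_of_tendsto hlim' ?_
  filter_upwards [hev, eventually_gt_atTop 0] with B ⟨s, hs, hv⟩ hB
  choose S hS using CachingScheme.IsUncoded.exists_cachesBits hs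
  have hB' : (0 : ℝ) < B := Nat.cast_pos.2 hB
  have hsum := mul_le_mul_of_nonneg_left (CachingScheme.le_sum_uncached hv hS) ha
  refine le_of_mul_le_mul_left ?_ hB'
  linarith [hbound B s S _ _ (CachingScheme.isPrivateUncoded hfull hv hS)]

theorem two_mul_sub_le_of_achievable_uncoded (hfull : ∀ d, demandLaw d ≠ 0)
    (h : Achievable (UncodedPlacement 2 N) demandLaw M R) : 2 * (N - M) ≤ N * R := by
  have hle := le_of_achievable_uncoded (a := 1) (b := 0) (c := 2) hfull zero_le_one h
    fun B s S η L hs => ?_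
  · linarith
  · have hsum := Finset.sum_le_sum fun f (_ : f ∈ Finset.univ) => hs.uncached_one_le f
    rw [Finset.sum_const, Finset.card_univ, Fintype.card_fin, nsmul_eq_mul] at hsum
    linarith

theorem six_mul_sub_le_of_achievable_uncoded (hN : 2 ≤ N) (hfull : ∀ d, demandLaw d ≠ 0)
    (h : Achievable (UncodedPlacement 2 N) demandLaw M R) : 6 * (N - M) ≤ N * (R + 1) := by
  obtain ⟨n, rfl⟩ := Nat.exists_eq_add_of_le' hN
  have hle := le_of_achievable_uncoded (a := 3) (b := 1) (c := 8) hfull zero_le_three h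
    fun B s S η L hs => ?_
  · linarith
  · have hsum := Finset.sum_le_sum fun f (_ : f ∈ Finset.univ) =>
      hs.uncached_two_le (f₁ := f) (f₂ := f + 1) (by simp)
    have hshift := Equiv.sum_comp (Equiv.addRight (1 : Fin (n + 2)))
      fun j => s.uncached S 0 j + s.uncached S 1 j
    simp only [Finset.sum_add_distrib, ← Finset.mul_sum, Finset.sum_const, Finset.card_univ,
      Fintype.card_fin, nsmul_eq_mul, Equiv.coe_addRight] at hsum hshift ⊢
    linarith

theorem twelve_mul_sub_le_of_achievable_uncoded (hN : 3 ≤ N) (hfull : ∀ d, demandLaw d ≠ 0)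
    (h : Achievable (UncodedPlacement 2 N) demandLaw M R) : 12 * (N - M) ≤ N * (R + 3) := by
  obtain ⟨n, rfl⟩ := Nat.exists_eq_add_of_le' hN
  have hle := le_of_achievable_uncoded (a := 6) (b := 3) (c := 18) hfull (by norm_num) h
    fun B s S η L hs => ?_
  · linarith
  · have hsum := Finset.sum_le_sum fun f (_ : f ∈ Finset.univ) =>
      hs.uncached_three_le (f₁ := f) (f₂ := f + 1) (f₃ := f + 2) (by simp)
        (by simp [Fin.ext_iff, Nat.mod_eq_of_lt]) (by simp [Fin.ext_iff, Nat.mod_eq_of_lt])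
    have hshift (c : Fin (n + 3)) := Equiv.sum_comp (Equiv.addRight c)
      fun j => s.uncached S 0 j + s.uncached S 1 j
    have hshift₁ := hshift 1
    have hshift₂ := hshift 2
    simp only [Finset.sum_add_distrib, ← Finset.mul_sum, Finset.sum_const, Finset.card_univ,
      Fintype.card_fin, nsmul_eq_mul, Equiv.coe_addRight] at hsum hshift₁ hshift₂ ⊢
    linarith

end Converse

namespace CachingScheme

section Perfect

variable {K N B : ℕ} (s : CachingScheme K N B) {demandLaw : PMF (Demands K N)}

/-- A scheme meets the encoding, decoding and privacy constraints exactly: payloads are functions of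
caches, the demanded file is a function of the payloads and the cache for every seed and demand
vector, and the metadata are private. -/
structure IsPerfect : Prop where
  encoding : ∀ k d w F F', s.content k (s.cacheMeta w k) F = s.content k (s.cacheMeta w k) F' →
    s.payload k (s.txMeta w d k) F = s.payload k (s.txMeta w d k) F'
  decoding : ∀ k d w F F', (∀ j, s.payload j (s.txMeta w d j) F = s.payload j (s.txMeta w d j) F') →
    s.content k (s.cacheMeta w k) F = s.content k (s.cacheMeta w k) F' → F (d k) = F' (d k)
  privacy : s.HasPrivateMetadata

/-- The number of bits that describe a cache. -/
def cacheBits : ℝ := Real.logb 2 (Fintype.card (s.CacheMeta × s.Content))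

/-- The number of bits that describe a signal. -/
def signalBits : ℝ := Real.logb 2 (Fintype.card (s.TxMeta × s.Payload))

theorem nonempty_cache (k : Fin K) : Nonempty (s.CacheMeta × s.Content) :=
  let ⟨w, _⟩ := s.seedLaw.support_nonempty
  ⟨(s.cacheMeta w k, s.content k (s.cacheMeta w k) 0)⟩

theorem nonempty_signal (k : Fin K) (d : Demands K N) : Nonempty (s.TxMeta × s.Payload) :=
  let ⟨w, _⟩ := s.seedLaw.support_nonempty
  ⟨(s.txMeta w d k, s.payload k (s.txMeta w d k) 0)⟩

variable {s}

theorem entropy_cache_le_cacheBits (k : Fin K) :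
    entropy (s.law demandLaw) (s.cache k) ≤ s.cacheBits :=
  have := s.nonempty_cache k
  entropy_le_logb_card _ _

theorem entropy_signal_le_signalBits (k : Fin K) :
    entropy (s.law demandLaw) (s.signal k) ≤ s.signalBits :=
  let ⟨d, _⟩ := demandLaw.support_nonempty
  have := s.nonempty_signal k d
  entropy_le_logb_card _ _

theorem HasPrivateMetadata.condMutualInfo_eq_zero (h : s.HasPrivateMetadata) (k : Fin K) :
    condMutualInfo (s.law demandLaw) s.demands (fun ω => (s.signals ω, s.cache k ω))
      (s.demand k) = 0 := by
  refine privacy_iff.2 fun d _ d' _ hd => ?_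
  let views (F : Library N B) (x : (Fin K → s.TxMeta) × s.CacheMeta) :
      (Fin K → s.TxMeta × s.Payload) × s.CacheMeta × s.Content :=
    (fun j => (x.1 j, s.payload j (x.1 j) F), (x.2, s.content k x.2 F))
  have hviews (d : Demands K N) : (prodLaw (uniformLibrary N B) s.seedLaw).map
        (fun ω => (s.signals (ω.1, d, ω.2), s.cache k (ω.1, d, ω.2))) =
      (uniformLibrary N B).bind fun F =>
        (s.seedLaw.map fun w => (s.txMeta w d, s.cacheMeta w k)).map (views F) := by
    simp only [prodLaw, PMF.map_bind, PMF.map_comp]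
    rfl
  rw [hviews, hviews, h k d d' hd]

theorem IsPerfect.isValid (h : s.IsPerfect) {M R ε : ℝ} (hε : 0 ≤ ε)
    (hM : s.cacheBits ≤ B * (M + ε)) (hR : K * s.signalBits ≤ B * (R + ε)) :
    s.IsValid demandLaw M R ε where
  memory k := (entropy_cache_le_cacheBits k).trans hM
  encoding k := by
    refine condEntropy_eq_zero_of_determined _ ?_
    rintro ⟨F, d, w⟩ ⟨F', d', w'⟩ heq
    simp only [packetMeta, cache, signal, Prod.mk.injEq] at heq ⊢
    obtain ⟨htx, hcache, hcontent⟩ := heq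
    rw [← hcache] at hcontent
    exact ⟨htx, htx ▸ h.encoding k d w F F' hcontent⟩
  decoding k := by
    rw [condEntropy_eq_zero_of_determined]
    · positivity
    rintro ⟨F, d, w⟩ ⟨F', d', w'⟩ heq
    simp only [packetMeta, cache, signals, signal, demand, demandedFile, Prod.mk.injEq,
      funext_iff (f := fun _ : Fin K => _)] at heq ⊢
    obtain ⟨hsignals, ⟨hcache, hcontent⟩, hdemand⟩ := heq
    rw [← hcache] at hcontent
    rw [← hdemand]
    exact h.decoding k d w F F' (fun j => (hsignals j).1 ▸ (hsignals j).2) hcontent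
  privacy k := h.privacy.condMutualInfo_eq_zero k
  load := by
    refine (Finset.sum_le_sum fun k _ => entropy_signal_le_signalBits k).trans ?_
    rwa [Finset.sum_const, Finset.card_univ, Fintype.card_fin, nsmul_eq_mul]

end Perfect

end CachingScheme

namespace SchemeB

open CachingScheme

section Share

variable {K N B₁ B₂ : ℕ} {s₁ : CachingScheme K N B₁} {s₂ : CachingScheme K N B₂}

theorem hasPrivateMetadata_share (h₁ : s₁.HasPrivateMetadata) (h₂ : s₂.HasPrivateMetadata) :
    (share s₁ s₂).HasPrivateMetadata := by
  intro k d d' hd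
  have hmap (d : Demands K N) : (share s₁ s₂).seedLaw.map (fun w =>
        ((share s₁ s₂).txMeta w d, (share s₁ s₂).cacheMeta w k)) =
      (s₁.seedLaw.map fun w => (s₁.txMeta w d, s₁.cacheMeta w k)).bind fun x =>
        (s₂.seedLaw.map fun w => (s₂.txMeta w d, s₂.cacheMeta w k)).map fun y =>
          ((fun j => (x.1 j, y.1 j)), (x.2, y.2)) := by
    simp only [share, PMF.map_bind, PMF.bind_map, PMF.map_comp]
    rfl
  rw [hmap, hmap, h₁ k d d' hd, h₂ k d d' hd]

theorem isPerfect_share (h₁ : s₁.IsPerfect) (h₂ : s₂.IsPerfect) : (share s₁ s₂).IsPerfect where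
  encoding k d w F F' h := by
    simp only [share, Prod.mk.injEq] at h ⊢
    exact ⟨h₁.encoding k d w.1 _ _ h.1, h₂.encoding k d w.2 _ _ h.2⟩
  decoding k d w F F' hj h := by
    simp only [share, Prod.mk.injEq] at h hj
    have hfst := h₁.decoding k d w.1 _ _ (fun j => (hj j).1) h.1
    have hsnd := h₂.decoding k d w.2 _ _ (fun j => (hj j).2) h.2
    exact funext (Fin.addCases (congrFun hfst) (congrFun hsnd))
  privacy := hasPrivateMetadata_share h₁.privacy h₂.privacy

theorem logb_card_prod_prod {α₁ α₂ β₁ β₂ : Type} [Fintype α₁] [Fintype α₂] [Fintype β₁]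
    [Fintype β₂] [Nonempty (α₁ × β₁)] [Nonempty (α₂ × β₂)] :
    Real.logb 2 (Fintype.card ((α₁ × α₂) × (β₁ × β₂))) =
      Real.logb 2 (Fintype.card (α₁ × β₁)) + Real.logb 2 (Fintype.card (α₂ × β₂)) := by
  rw [← Real.logb_mul (Nat.cast_ne_zero.2 Fintype.card_ne_zero)
    (Nat.cast_ne_zero.2 Fintype.card_ne_zero), ← Nat.cast_mul, ← Fintype.card_prod,
    Fintype.card_congr (Equiv.prodProdProdComm α₁ α₂ β₁ β₂)]

theorem cacheBits_share (k : Fin K) :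
    (share s₁ s₂).cacheBits = s₁.cacheBits + s₂.cacheBits :=
  have := s₁.nonempty_cache k
  have := s₂.nonempty_cache k
  logb_card_prod_prod

theorem signalBits_share (k : Fin K) (d : Demands K N) :
    (share s₁ s₂).signalBits = s₁.signalBits + s₂.signalBits :=
  have := s₁.nonempty_signal k d
  have := s₂.nonempty_signal k d
  logb_card_prod_prod

end Share

section CacheAll

variable (N B : ℕ)

theorem isPerfect_cacheAll : (cacheAll N B).IsPerfect where
  encoding _ _ _ _ _ _ := rfl
  decoding _ d _ _ _ _ h := congrFun h (d _)
  privacy _ _ _ _ := rfl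

theorem cacheBits_cacheAll : (cacheAll N B).cacheBits = N * B := by
  have hcard : Fintype.card (Unit × Library N B) = 2 ^ (B * N) := by
    simp [pow_mul]
  calc (cacheAll N B).cacheBits = Real.logb 2 (Fintype.card (Unit × Library N B)) := rfl
    _ = N * B := by
      rw [hcard, Nat.cast_pow, Real.logb_pow, Nat.cast_two, Real.logb_self_eq_one one_lt_two]
      push_cast
      ring

theorem signalBits_cacheAll : (cacheAll N B).signalBits = 0 := by
  change Real.logb 2 (Fintype.card (Unit × Unit)) = 0
  simp

end CacheAll

section Combinatorics

theorem map_equiv_uniformOfFintype {α β : Type*} [Fintype α] [Fintype β] [Nonempty α] [Nonempty β]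
    (e : α ≃ β) : (PMF.uniformOfFintype α).map e = PMF.uniformOfFintype β := by
  classical
  ext b
  rw [PMF.map_apply, tsum_eq_single (e.symm b) fun a ha => if_neg fun h => ha (by simp [h])]
  simp [Fintype.card_congr e]

theorem exists_injective_val_lt_iff {α : Type*} [Fintype α] (p : α → Prop) [DecidablePred p]
    {m n : ℕ} (hm : Fintype.card {a // p a} ≤ m) (hn : Fintype.card {a // ¬p a} ≤ n) :
    ∃ f : α → Fin (m + n), Function.Injective f ∧ ∀ a, (f a : ℕ) < m ↔ p a := by
  obtain ⟨e₁⟩ := Function.Embedding.nonempty_of_card_le (hm.trans_eq (Fintype.card_fin m).symm)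
  obtain ⟨e₂⟩ := Function.Embedding.nonempty_of_card_le (hn.trans_eq (Fintype.card_fin n).symm)
  refine ⟨finSumFinEquiv ∘ Sum.map e₁ e₂ ∘ (Equiv.sumCompl p).symm,
    finSumFinEquiv.injective.comp
      ((e₁.injective.sumMap e₂.injective).comp (Equiv.injective _)), fun a => ?_⟩
  by_cases h : p a <;> simp [h]

theorem exists_eq_of_injective_of_le_val {α : Type*} [Fintype α] {m n : ℕ} {f : α → Fin (m + n)}
    (hf : Function.Injective f) (hcard : Fintype.card α = n) (hle : ∀ a, m ≤ (f a : ℕ))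
    (r : Fin (m + n)) (hr : m ≤ (r : ℕ)) : ∃ a, f a = r := by
  have hnatAdd (x : Fin (m + n)) (hx : m ≤ (x : ℕ)) : ∃ y, Fin.natAdd m y = x :=
    ⟨Fin.subNat m (x.cast (Nat.add_comm m n)) hx, by simp⟩
  choose g hg using fun a => hnatAdd (f a) (hle a)
  have hginj : Function.Injective g := fun a b h => hf (by rw [← hg, ← hg, h])
  obtain ⟨y, rfl⟩ := hnatAdd r hr
  obtain ⟨a, rfl⟩ := ((Fintype.bijective_iff_injective_and_card g).2
    ⟨hginj, by rw [hcard, Fintype.card_fin]⟩).2 y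
  exact ⟨a, (hg a).symm⟩

theorem card_filter_card_eq_subset {α : Type*} [Fintype α] [DecidableEq α] (A : Finset α) (m : ℕ) :
    (Finset.univ.filter fun S : Finset α => S.card = m + A.card ∧ A ⊆ S).card =
      (Fintype.card α - A.card).choose m := by
  rw [← Finset.card_compl, ← Finset.card_powersetCard]
  refine Finset.card_bij' (fun S _ => S \ A) (fun T _ => T ∪ A) ?_ ?_ ?_ ?_
  · simp only [Finset.mem_filter, Finset.mem_univ, true_and, Finset.mem_powersetCard]
    intro S hS
    refine ⟨fun x hx => Finset.mem_compl.2 (Finset.mem_sdiff.1 hx).2, ?_⟩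
    rw [Finset.card_sdiff_of_subset hS.2, hS.1, Nat.add_sub_cancel]
  · simp only [Finset.mem_filter, Finset.mem_univ, true_and, Finset.mem_powersetCard]
    intro T hT
    refine ⟨?_, Finset.subset_union_right⟩
    rw [Finset.card_union_of_disjoint (Finset.disjoint_left.2 fun x hx =>
      Finset.mem_compl.1 (hT.1 hx)), hT.2]
  · exact fun S hS => Finset.sdiff_union_of_subset (Finset.mem_filter.1 hS).2.2
  · exact fun T hT => Finset.union_sdiff_cancel_right (Finset.disjoint_left.2 fun x hx =>
      Finset.mem_compl.1 ((Finset.mem_powersetCard.1 hT).1 hx))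

end Combinatorics

section PickRule

variable {N t : ℕ}

/-- The groups of `t + 1` files with the file `i`. -/
abbrev GroupOf (t : ℕ) (i : Fin N) : Type := {S : Group N t // i ∈ S.1}

theorem card_groupOf (i : Fin N) : Fintype.card (GroupOf t i) = (N - 1).choose t := by
  have h := card_filter_card_eq_subset {i} t
  simp only [Finset.card_singleton, Finset.singleton_subset_iff, Fintype.card_fin] at h
  rw [← h, ← Fintype.card_subtype]
  exact Fintype.card_congr (Equiv.subtypeSubtypeEquivSubtypeInter _ fun S : Finset (Fin N) => i ∈ S)

theorem card_groupOf_mem_le (d i : Fin N) :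
    Fintype.card {S : GroupOf t i // d ∈ S.1.1 ∧ i ≠ d} ≤ sharedCount N t := by
  obtain rfl | hid := eq_or_ne i d
  · simp
  have hpair := Finset.card_pair hid
  cases t with
  | zero =>
    have : IsEmpty {S : GroupOf 0 i // d ∈ S.1.1 ∧ i ≠ d} := ⟨fun S => by
      have hle := Finset.card_le_card
        (Finset.insert_subset S.1.2 (Finset.singleton_subset_iff.2 S.2.1))
      rw [hpair, S.1.1.2] at hle
      omega⟩
    simp [Fintype.card_eq_zero]
  | succ t =>
    have h := card_filter_card_eq_subset {i, d} t
    rw [hpair, Fintype.card_fin, ← Fintype.card_subtype] at h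
    rw [sharedCount, ← h]
    refine Fintype.card_le_of_injective (fun S => ⟨S.1.1.1, S.1.1.2,
      Finset.insert_subset S.1.2 (Finset.singleton_subset_iff.2 S.2.1)⟩) fun S S' h => ?_
    simpa only [Subtype.ext_iff] using h

theorem exists_isPickRule (N t : ℕ) :
    ∃ pick : Fin N → (S : Group N t) → {i // i ∈ S.1} → Fin (subfileCount N t),
      IsPickRule N t pick := by
  choose f hf hlt using fun d i : Fin N =>
    exists_injective_val_lt_iff (fun S : GroupOf t i => d ∈ S.1.1 ∧ i ≠ d)
      (card_groupOf_mem_le d i)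
      ((Fintype.card_subtype_le _).trans_eq (card_groupOf i))
  exact ⟨fun d S i => f d i.1 ⟨S, i.2⟩,
    fun d i S S' h h' heq => congrArg Subtype.val (hf d i heq), fun d S i => hlt d i.1 ⟨S, i.2⟩⟩

variable {pick : Fin N → (S : Group N t) → {i // i ∈ S.1} → Fin (subfileCount N t)}

theorem IsPickRule.injective_groupOf (hpick : IsPickRule N t pick) (d i : Fin N) :
    Function.Injective fun S : GroupOf t i => pick d S.1 ⟨i, S.2⟩ :=
  fun S S' h => Subtype.ext (hpick.injective d i S.1 S'.1 S.2 S'.2 h)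

theorem IsPickRule.exists_pick_eq (hpick : IsPickRule N t pick) (d : Fin N)
    (r : Fin (subfileCount N t)) (hr : sharedCount N t ≤ r) :
    ∃ (S : Group N t) (h : d ∈ S.1), pick d S ⟨d, h⟩ = r := by
  obtain ⟨S, hS⟩ := exists_eq_of_injective_of_le_val (hpick.injective_groupOf d d)
    (card_groupOf d)
    (fun S => not_lt.1 ((hpick.shared_iff d S.1 ⟨d, S.2⟩).not.2 fun h => h.2 rfl)) r hr
  exact ⟨S.1, S.2, hS⟩

end PickRule

section Corner

variable {N t ℓ : ℕ}
  {pick : Fin N → (S : Group N t) → {i // i ∈ S.1} → Fin (subfileCount N t)}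

theorem rev_ne_self (k : Fin 2) : k.rev ≠ k := by
  revert k
  decide

theorem eq_rev_of_ne {j k : Fin 2} (h : j ≠ k) : j = k.rev := by
  revert j k
  decide

theorem exists_position_eq {U : ℕ} (x : Fin (2 * (U * ℓ))) : ∃ k j b, position k j b = x := by
  obtain ⟨⟨k, y⟩, rfl⟩ := finProdFinEquiv.surjective x
  obtain ⟨⟨j, b⟩, rfl⟩ := finProdFinEquiv.surjective y
  exact ⟨k, j, b, rfl⟩

/-- User `k` sees the permutations of its own half only through the picked subfiles. Composing them
with permutations that match the picks for `d` to those for `d'` preserves the law of the seed. -/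
theorem hasPrivateMetadata_corner (hpick : IsPickRule N t pick) :
    (corner N t ℓ pick).HasPrivateMetadata := by
  intro k d d' hd
  choose τ hτ using fun i => Equiv.Perm.exists_extending_pair _ _
    (hpick.injective_groupOf (d k.rev) i) (hpick.injective_groupOf (d' k.rev) i)
  let g : Fin 2 → Fin N → Equiv.Perm (Fin (subfileCount N t)) := Pi.mulSingle k τ
  have hgk : g k = τ := by simp [g]
  have hgrev : g k.rev = 1 := by simp [g, rev_ne_self]
  let views (d : Demands 2 N) (w : Fin 2 → Fin N → Equiv.Perm (Fin (subfileCount N t))) :=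
    ((corner N t ℓ pick).txMeta w d, (corner N t ℓ pick).cacheMeta w k)
  have hviews : views d' = views d ∘ Equiv.mulRight g := by
    funext w
    refine Prod.ext (funext fun j => funext fun S => funext fun i => ?_)
      (funext fun i => funext fun j => ?_)
    · change w j i.1 (pick (d' j.rev) S i) = w j i.1 (g j i.1 (pick (d j.rev) S i))
      obtain rfl | hj := eq_or_ne j k
      · rw [hgk]
        exact congrArg (w j i.1) (hτ i.1 ⟨S, i.2⟩).symm
      · obtain rfl := eq_rev_of_ne hj
        rw [hgrev, Fin.rev_rev, hd]
        rfl
    · change w k.rev i (Fin.castAdd _ j) = w k.rev i (g k.rev i (Fin.castAdd _ j))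
      rw [hgrev]
      rfl
  change (PMF.uniformOfFintype _).map (views d) = (PMF.uniformOfFintype _).map (views d')
  rw [hviews, ← PMF.map_comp, map_equiv_uniformOfFintype]

theorem content_corner_eq_iff {k : Fin 2} {m : (corner N t ℓ pick).CacheMeta} {F F' : Library N _} :
    (corner N t ℓ pick).content k m F = (corner N t ℓ pick).content k m F' ↔
      (∀ i j b, F i (position k j b) = F' i (position k j b)) ∧
        ∀ i j b, F i (position k.rev (m i j) b) = F' i (position k.rev (m i j) b) := by
  simp only [corner, Prod.mk.injEq, funext_iff]

theorem decoding_corner (hpick : IsPickRule N t pick) (k : Fin 2) (d : Demands 2 N)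
    (w : (corner N t ℓ pick).Seed) (F F' : Library N _)
    (hp : ∀ j, (corner N t ℓ pick).payload j ((corner N t ℓ pick).txMeta w d j) F =
      (corner N t ℓ pick).payload j ((corner N t ℓ pick).txMeta w d j) F')
    (hc : (corner N t ℓ pick).content k ((corner N t ℓ pick).cacheMeta w k) F =
      (corner N t ℓ pick).content k ((corner N t ℓ pick).cacheMeta w k) F') :
    F (d k) = F' (d k) := by
  obtain ⟨hown, hcached⟩ := content_corner_eq_iff.1 hc
  have hshared (i : Fin N) (r : Fin (subfileCount N t)) (b : Fin ℓ)
      (hr : (r : ℕ) < sharedCount N t) :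
      F i (position k.rev (w k.rev i r) b) = F' i (position k.rev (w k.rev i r) b) :=
    hcached i ⟨r, hr⟩ b
  ext x
  obtain ⟨j, r', b, rfl⟩ := exists_position_eq x
  obtain rfl | hj := eq_or_ne j k
  · exact hown _ _ _
  obtain rfl := eq_rev_of_ne hj
  obtain ⟨r, rfl⟩ := (w k.rev (d k)).surjective r'
  by_cases hr : (r : ℕ) < sharedCount N t
  · exact hshared _ r b hr
  obtain ⟨S, hS, rfl⟩ := hpick.exists_pick_eq (d k) r (not_lt.1 hr)
  have hsum : ∑ i : {i // i ∈ S.1},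
        F i.1 (position k.rev (w k.rev i.1 (pick (d k.rev.rev) S i)) b) =
      ∑ i : {i // i ∈ S.1},
        F' i.1 (position k.rev (w k.rev i.1 (pick (d k.rev.rev) S i)) b) :=
    congrFun (congrFun (hp k.rev) S) b
  have hothers (i : {i // i ∈ S.1}) (hi : i ∈ Finset.univ.erase ⟨d k, hS⟩) :=
    hshared i.1 (pick (d k) S i) b ((hpick.shared_iff (d k) S i).2
      ⟨hS, fun h => Finset.ne_of_mem_erase hi (Subtype.ext h)⟩)
  rw [Fin.rev_rev, ← Finset.add_sum_erase _ _ (Finset.mem_univ ⟨d k, hS⟩),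
    ← Finset.add_sum_erase _ _ (Finset.mem_univ ⟨d k, hS⟩), Finset.sum_congr rfl hothers] at hsum
  exact add_right_cancel hsum

theorem isPerfect_corner (hpick : IsPickRule N t pick) : (corner N t ℓ pick).IsPerfect where
  encoding _ _ _ _ _ hc := funext fun _ => funext fun _ =>
    Finset.sum_congr rfl fun _ _ => (content_corner_eq_iff.1 hc).1 _ _ _
  decoding := decoding_corner hpick
  privacy := hasPrivateMetadata_corner hpick

theorem logb_card_prod_of_card_eq_two_pow {α β : Type*} [Fintype α] [Fintype β] [Nonempty (α × β)]
    {n : ℕ} (hβ : Fintype.card β = 2 ^ n) :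
    Real.logb 2 (Fintype.card (α × β)) = Real.logb 2 (Fintype.card α) + n := by
  have : Nonempty α := (nonempty_prod.1 ‹_›).1
  rw [Fintype.card_prod, hβ, Nat.cast_mul, Real.logb_mul (Nat.cast_ne_zero.2 Fintype.card_ne_zero)
    (Nat.cast_ne_zero.2 (pow_ne_zero n two_ne_zero)), Nat.cast_pow, Real.logb_pow, Nat.cast_two,
    Real.logb_self_eq_one one_lt_two, mul_one]

theorem cacheBits_corner : (corner N t ℓ pick).cacheBits =
    Real.logb 2 (Fintype.card (Fin N → Fin (sharedCount N t) → Fin (subfileCount N t))) +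
      (N * (subfileCount N t + sharedCount N t) : ℝ) * ℓ := by
  have := (corner N t ℓ pick).nonempty_cache 0
  have hcard : Fintype.card (corner N t ℓ pick).Content =
      2 ^ (N * (subfileCount N t + sharedCount N t) * ℓ) := by
    change Fintype.card ((Fin N → Fin (subfileCount N t) → Fin ℓ → ZMod 2) ×
      (Fin N → Fin (sharedCount N t) → Fin ℓ → ZMod 2)) = _
    simp only [Fintype.card_prod, Fintype.card_fun, Fintype.card_fin, ZMod.card]
    ring
  rw [cacheBits, logb_card_prod_of_card_eq_two_pow hcard]
  push_cast
  rfl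

theorem signalBits_corner (d : Demands 2 N) : (corner N t ℓ pick).signalBits =
    Real.logb 2 (Fintype.card ((S : Group N t) → {i // i ∈ S.1} → Fin (subfileCount N t))) +
      (N.choose (t + 1) : ℝ) * ℓ := by
  have := (corner N t ℓ pick).nonempty_signal 0 d
  have hcard : Fintype.card (corner N t ℓ pick).Payload = 2 ^ (N.choose (t + 1) * ℓ) := by
    change Fintype.card (Group N t → Fin ℓ → ZMod 2) = _
    simp only [Fintype.card_fun, Fintype.card_fin, ZMod.card, Fintype.card_finset_len]
    ring
  rw [signalBits, logb_card_prod_of_card_eq_two_pow hcard]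
  push_cast
  rfl

end Corner

section Uncoded

theorem isUncoded_corner {N t : ℕ} (ℓ : ℕ)
    (pick : Fin N → (S : Group N t) → {i // i ∈ S.1} → Fin (subfileCount N t)) :
    (corner N t ℓ pick).IsUncoded := by
  refine fun k m => ⟨Set.range (fun x : Fin N × _ × _ => (x.1, position k x.2.1 x.2.2)) ∪
    Set.range (fun x : Fin N × _ × _ => (x.1, position k.rev (m x.1 x.2.1) x.2.2)),
    fun F F' => content_corner_eq_iff.trans ?_⟩
  simp only [Set.mem_union, or_imp, forall_and, Set.forall_mem_range, Prod.forall]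

theorem isUncoded_cacheAll (N B : ℕ) : (cacheAll N B).IsUncoded := by
  refine fun _ _ => ⟨Set.univ, fun F F' => ?_⟩
  simp only [cacheAll, funext_iff, Set.mem_univ, true_imp_iff, Prod.forall]

theorem isUncoded_share {K N B₁ B₂ : ℕ} {s₁ : CachingScheme K N B₁} {s₂ : CachingScheme K N B₂}
    (h₁ : s₁.IsUncoded) (h₂ : s₂.IsUncoded) : (share s₁ s₂).IsUncoded := by
  intro k m
  obtain ⟨S₁, hS₁⟩ := h₁ k m.1
  obtain ⟨S₂, hS₂⟩ := h₂ k m.2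
  refine ⟨(fun x => (x.1, Fin.castAdd B₂ x.2)) '' S₁ ∪ (fun x => (x.1, Fin.natAdd B₁ x.2)) '' S₂,
    fun F F' => ?_⟩
  simp only [share, Prod.mk.injEq, hS₁, hS₂, Set.mem_union, or_imp, forall_and,
    Set.forall_mem_image]

theorem IsSchemeB.isUncoded {N B : ℕ} {s : CachingScheme 2 N B} (h : IsSchemeB N B s) :
    s.IsUncoded := by
  induction h with
  | corner t ℓ _ pick _ => exact isUncoded_corner ℓ pick
  | cacheAll B => exact isUncoded_cacheAll N B
  | share _ _ _ _ ih₁ ih₂ => exact isUncoded_share ih₁ ih₂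

end Uncoded

section Attains

variable {N B : ℕ}

/-- A perfect scheme of Scheme B whose caches need `B * p.1` bits and whose two signals together
need `B * p.2` bits, up to `c` bits in each case. -/
structure Attains (s : CachingScheme 2 N B) (p : ℝ × ℝ) (c : ℝ) : Prop where
  isSchemeB : IsSchemeB N B s
  isPerfect : s.IsPerfect
  cacheBits_le : s.cacheBits ≤ B * p.1 + c
  signalBits_le : 2 * s.signalBits ≤ B * p.2 + c

theorem attains_cacheAll (N B : ℕ) : Attains (cacheAll N B) (N, 0) 0 where
  isSchemeB := .cacheAll B
  isPerfect := isPerfect_cacheAll N B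
  cacheBits_le := by rw [cacheBits_cacheAll, add_zero, mul_comm]
  signalBits_le := by simp [signalBits_cacheAll]

theorem Attains.share [NeZero N] {B₁ B₂ : ℕ} {s₁ : CachingScheme 2 N B₁}
    {s₂ : CachingScheme 2 N B₂} {p q r : ℝ × ℝ} {c₁ c₂ c : ℝ} (h₁ : Attains s₁ p c₁)
    (h₂ : Attains s₂ q c₂) (hfst : B₁ * p.1 + B₂ * q.1 ≤ ((B₁ + B₂ : ℕ) : ℝ) * r.1 + c)
    (hsnd : B₁ * p.2 + B₂ * q.2 ≤ ((B₁ + B₂ : ℕ) : ℝ) * r.2 + c) :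
    Attains (share s₁ s₂) r (c₁ + c₂ + c) where
  isSchemeB := .share s₁ s₂ h₁.isSchemeB h₂.isSchemeB
  isPerfect := isPerfect_share h₁.isPerfect h₂.isPerfect
  cacheBits_le := by
    rw [cacheBits_share 0]
    linarith [h₁.cacheBits_le, h₂.cacheBits_le]
  signalBits_le := by
    rw [signalBits_share 0 0]
    linarith [h₁.signalBits_le, h₂.signalBits_le]

/-- For every file size, Scheme B attains the pair `p` of cache size and load up to a constant
number of bits. -/
def IsAttainable (N : ℕ) (p : ℝ × ℝ) : Prop :=
  ∃ c : ℝ, ∀ B : ℕ, ∃ s : CachingScheme 2 N B, Attains s p c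

theorem IsAttainable.achievable {p : ℝ × ℝ} (h : IsAttainable N p)
    (demandLaw : PMF (Demands 2 N)) : Achievable (IsSchemeB N) demandLaw p.1 p.2 := by
  obtain ⟨c, hc⟩ := h
  refine ⟨fun B => |c| / B, fun B => by positivity,
    tendsto_const_div_atTop_nhds_zero_nat |c|, ?_⟩
  filter_upwards [eventually_gt_atTop 0] with B hB
  obtain ⟨s, hs⟩ := hc B
  have hslack (x : ℝ) : B * x + c ≤ B * (x + |c| / B) := by
    rw [mul_add, mul_div_cancel₀ _ (Nat.cast_ne_zero.2 hB.ne')]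
    exact add_le_add_right (le_abs_self c) _
  exact ⟨s, hs.isSchemeB, hs.isPerfect.isValid (by positivity) (hs.cacheBits_le.trans (hslack _))
    (hs.signalBits_le.trans (hslack _))⟩

theorem exists_add_eq_forall_mul_add_mul_le {a b : ℝ} (ha : 0 ≤ a) (hb : 0 ≤ b) (hab : a + b = 1)
    (B : ℕ) : ∃ B₁ B₂ : ℕ, B₁ + B₂ = B ∧
      ∀ x y : ℝ, B₁ * x + B₂ * y ≤ B * (a * x + b * y) + (|x| + |y|) := by
  have hfloor : ⌊a * (B : ℝ)⌋₊ ≤ B :=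
    Nat.floor_le_of_le (mul_le_of_le_one_left (Nat.cast_nonneg B) (by linarith))
  refine ⟨⌊a * (B : ℝ)⌋₊, B - ⌊a * (B : ℝ)⌋₊, Nat.add_sub_cancel' hfloor, fun x y => ?_⟩
  have hround : |(⌊a * (B : ℝ)⌋₊ : ℝ) - a * B| ≤ 1 := by
    rw [abs_le]
    constructor <;> linarith [Nat.lt_floor_add_one (a * (B : ℝ)),
      Nat.floor_le (mul_nonneg ha (Nat.cast_nonneg B))]
  have hle : ((⌊a * (B : ℝ)⌋₊ : ℝ) - a * B) * (x - y) ≤ |x| + |y| := by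
    refine (le_abs_self _).trans ?_
    rw [abs_mul]
    exact (mul_le_of_le_one_left (abs_nonneg _) hround).trans (abs_sub x y)
  rw [Nat.cast_sub hfloor, ← sub_eq_of_eq_add' hab.symm]
  linarith

theorem convex_isAttainable (N : ℕ) [NeZero N] : Convex ℝ {p | IsAttainable N p} := by
  rintro p ⟨c₁, hp⟩ q ⟨c₂, hq⟩ a b ha hb hab
  refine ⟨c₁ + c₂ + (|p.1| + |q.1| + (|p.2| + |q.2|)), fun B => ?_⟩
  obtain ⟨B₁, B₂, rfl, hle⟩ := exists_add_eq_forall_mul_add_mul_le ha hb hab B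
  obtain ⟨s₁, h₁⟩ := hp B₁
  obtain ⟨s₂, h₂⟩ := hq B₂
  refine ⟨SchemeB.share s₁ s₂, h₁.share h₂ ((hle _ _).trans ?_) ((hle _ _).trans ?_)⟩
  · exact add_le_add_right (le_add_of_nonneg_right (by positivity)) _
  · exact add_le_add_right (le_add_of_nonneg_left (by positivity)) _

end Attains

section CornerPoints

variable {N t : ℕ}

/-- The corner point (cache size, load) of index `t`. -/
def cornerPoint (N t : ℕ) : ℝ × ℝ :=
  ((N : ℝ) / 2 + (N : ℝ) * t / (2 * ((N : ℝ) + t - 1)),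
    (N : ℝ) * ((N : ℝ) - 1) / (((t : ℝ) + 1) * ((N : ℝ) + t - 1)))

theorem sharedCount_mul (n t : ℕ) : sharedCount (n + 2) t * (n + 1) = t * (n + 1).choose t := by
  cases t with
  | zero => simp [sharedCount]
  | succ t =>
    rw [sharedCount, mul_comm, mul_comm (t + 1)]
    exact Nat.add_one_mul_choose_eq n t

theorem subfileCount_mul (n t : ℕ) :
    subfileCount (n + 2) t * (n + 1) = (n + 1 + t) * (n + 1).choose t := by
  rw [subfileCount, add_mul, sharedCount_mul]
  simp only [Nat.add_succ_sub_one]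
  ring

theorem cornerPoint_fst_mul (hN : 2 ≤ N) :
    (cornerPoint N t).1 * (2 * subfileCount N t) = N * (subfileCount N t + sharedCount N t) := by
  obtain ⟨n, rfl⟩ := Nat.exists_eq_add_of_le' hN
  have hshared : (sharedCount (n + 2) t * (n + 1) : ℝ) = t * (n + 1).choose t := by
    exact_mod_cast sharedCount_mul n t
  have hsubfile : (subfileCount (n + 2) t * (n + 1) : ℝ) = (n + 1 + t) * (n + 1).choose t := by
    exact_mod_cast subfileCount_mul n t
  have hpos : (n : ℝ) + 1 + t ≠ 0 := by positivity
  have heq : (t : ℝ) * subfileCount (n + 2) t = (n + 1 + t) * sharedCount (n + 2) t := by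
    refine mul_right_cancel₀ (b := (n : ℝ) + 1) (by positivity) ?_
    rw [mul_assoc, mul_assoc, hshared, hsubfile]
    ring
  have hden : ((n + 2 : ℕ) : ℝ) + t - 1 = n + 1 + t := by
    push_cast
    ring
  rw [cornerPoint, hden]
  field_simp
  linear_combination heq

theorem cornerPoint_snd_mul (hN : 2 ≤ N) :
    (cornerPoint N t).2 * subfileCount N t = N.choose (t + 1) := by
  obtain ⟨n, rfl⟩ := Nat.exists_eq_add_of_le' hN
  have hsubfile : (subfileCount (n + 2) t * (n + 1) : ℝ) = (n + 1 + t) * (n + 1).choose t := by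
    exact_mod_cast subfileCount_mul n t
  have hchoose : ((n + 2) * (n + 1).choose t : ℝ) = (n + 2).choose (t + 1) * (t + 1) := by
    exact_mod_cast Nat.add_one_mul_choose_eq (n + 1) t
  have hpos : (n : ℝ) + 1 + t ≠ 0 := by positivity
  have hden : ((n + 2 : ℕ) : ℝ) + t - 1 = n + 1 + t := by
    push_cast
    ring
  rw [cornerPoint, hden]
  push_cast
  field_simp
  linear_combination (n + 2 : ℝ) * hsubfile + (n + 1 + t : ℝ) * hchoose

theorem exists_forall_attains_corner (hN : 2 ≤ N) (ht : t < N)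
    {pick : Fin N → (S : Group N t) → {i // i ∈ S.1} → Fin (subfileCount N t)}
    (hpick : IsPickRule N t pick) :
    ∃ c, ∀ ℓ, Attains (corner N t ℓ pick) (cornerPoint N t) c := by
  refine ⟨max (Real.logb 2 (Fintype.card (Fin N → Fin (sharedCount N t) → Fin (subfileCount N t))))
    (2 * Real.logb 2 (Fintype.card
      ((S : Group N t) → {i // i ∈ S.1} → Fin (subfileCount N t)))),
    fun ℓ => ⟨.corner t ℓ ht pick hpick, isPerfect_corner hpick, ?_, ?_⟩⟩
  · rw [cacheBits_corner, ← cornerPoint_fst_mul hN, add_comm]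
    refine add_le_add (le_of_eq ?_) (le_max_left _ _)
    push_cast
    ring
  · rw [signalBits_corner fun _ => ⟨0, by omega⟩, ← cornerPoint_snd_mul hN, add_comm, mul_add]
    refine add_le_add (le_of_eq ?_) (le_max_right _ _)
    push_cast
    ring

theorem cornerPoint_nonneg (hN : 2 ≤ N) : 0 ≤ cornerPoint N t := by
  have hN' : (2 : ℝ) ≤ N := by exact_mod_cast hN
  have hden : 0 ≤ (N : ℝ) + t - 1 := by linarith [(Nat.cast_nonneg t : (0 : ℝ) ≤ t)]
  have hsub : 0 ≤ (N : ℝ) - 1 := by linarith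
  constructor <;> simp only [cornerPoint, Prod.fst_zero, Prod.snd_zero] <;> positivity

theorem isAttainable_cornerPoint (hN : 2 ≤ N) (ht : t < N) : IsAttainable N (cornerPoint N t) := by
  have : NeZero N := ⟨by omega⟩
  obtain ⟨pick, hpick⟩ := exists_isPickRule N t
  have hpos : 0 < subfileCount N t :=
    Nat.add_pos_right _ (Nat.choose_pos (Nat.le_sub_one_of_lt ht))
  obtain ⟨c, hc⟩ := exists_forall_attains_corner hN ht hpick
  refine ⟨c + 0 + 2 * subfileCount N t * N, fun B => ?_⟩
  obtain ⟨ℓ, r, hr, rfl⟩ : ∃ ℓ r : ℕ, r < 2 * subfileCount N t ∧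
      2 * (subfileCount N t * ℓ) + r = B :=
    ⟨B / (2 * subfileCount N t), B % (2 * subfileCount N t), Nat.mod_lt _ (by omega), by
      rw [← mul_assoc, Nat.div_add_mod]⟩
  have hr' : (r : ℝ) ≤ 2 * subfileCount N t := by exact_mod_cast hr.le
  have hnonneg := cornerPoint_nonneg (t := t) hN
  refine ⟨share (corner N t ℓ pick) (cacheAll N r), (hc ℓ).share (attains_cacheAll N r) ?_ ?_⟩
  · rw [Nat.cast_add, add_mul, add_assoc]
    gcongr
    exact le_add_of_nonneg_of_le (mul_nonneg r.cast_nonneg hnonneg.1) (by gcongr)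
  · rw [Nat.cast_add, add_mul, add_assoc, mul_zero]
    gcongr
    exact add_nonneg (mul_nonneg r.cast_nonneg hnonneg.2) (by positivity)

theorem isAttainable_of_mem_convexHull (hN : 2 ≤ N) {p : ℝ × ℝ}
    (hp : p ∈ convexHull ℝ (cornerPoints N)) : IsAttainable N p := by
  have : NeZero N := ⟨by omega⟩
  refine convexHull_min ?_ (convex_isAttainable N) hp
  rintro _ (rfl | ⟨t, ht, rfl⟩)
  · exact ⟨0, fun B => ⟨_, attains_cacheAll N B⟩⟩
  · exact isAttainable_cornerPoint hN ht

end CornerPoints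

section ConvexHull

theorem cornerPoint_mem_convexHull {N t : ℕ} (ht : t < N) :
    cornerPoint N t ∈ convexHull ℝ (cornerPoints N) :=
  subset_convexHull ℝ _ (Or.inr ⟨t, ht, rfl⟩)

theorem natCast_zero_mem_convexHull (N : ℕ) : ((N : ℝ), (0 : ℝ)) ∈ convexHull ℝ (cornerPoints N) :=
  subset_convexHull ℝ _ (Or.inl rfl)

theorem mem_of_segment {s : Set (ℝ × ℝ)} (hs : Convex ℝ s) {x₁ y₁ x₂ y₂ x y : ℝ}
    (h₁ : (x₁, y₁) ∈ s) (h₂ : (x₂, y₂) ∈ s) (hlt : x₁ < x₂) (hx : x ∈ Set.Icc x₁ x₂)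
    (hy : y * (x₂ - x₁) = y₁ * (x₂ - x) + y₂ * (x - x₁)) : (x, y) ∈ s := by
  have hd : 0 < x₂ - x₁ := sub_pos.2 hlt
  have h := hs h₁ h₂ (a := (x₂ - x) / (x₂ - x₁)) (b := (x - x₁) / (x₂ - x₁))
    (div_nonneg (sub_nonneg.2 hx.2) hd.le) (div_nonneg (sub_nonneg.2 hx.1) hd.le)
    (by field_simp; ring)
  convert h using 1
  ext
  · simp only [Prod.fst_add, Prod.smul_fst, smul_eq_mul]
    field_simp
    ring
  · simp only [Prod.snd_add, Prod.smul_snd, smul_eq_mul]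
    field_simp
    linarith

theorem exists_mem_convexHull_two {M : ℝ} (hM : M ∈ Set.Icc (1 : ℝ) 2) :
    ∃ r, (M, r) ∈ convexHull ℝ (cornerPoints 2) ∧ (r = 5 - 3 * M ∨ r = 2 - M) := by
  have h₀ : ((1 : ℝ), (2 : ℝ)) ∈ convexHull ℝ (cornerPoints 2) := by
    convert cornerPoint_mem_convexHull (N := 2) (t := 0) (by norm_num) using 1
    norm_num [cornerPoint]
  have h₁ : ((3 / 2 : ℝ), (1 / 2 : ℝ)) ∈ convexHull ℝ (cornerPoints 2) := by
    convert cornerPoint_mem_convexHull (N := 2) (t := 1) (by norm_num) using 1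
    norm_num [cornerPoint]
  have h₂ : ((2 : ℝ), (0 : ℝ)) ∈ convexHull ℝ (cornerPoints 2) := natCast_zero_mem_convexHull 2
  rcases le_total M (3 / 2) with h | h
  · exact ⟨_, mem_of_segment (convex_convexHull ℝ _) h₀ h₁ (by norm_num) ⟨hM.1, h⟩ (by ring),
      Or.inl rfl⟩
  · exact ⟨_, mem_of_segment (convex_convexHull ℝ _) h₁ h₂ (by norm_num) ⟨h, hM.2⟩ (by ring),
      Or.inr rfl⟩

theorem exists_mem_convexHull_three {M : ℝ} (hM : M ∈ Set.Icc (3 / 2 : ℝ) 3) :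
    ∃ r, (M, r) ∈ convexHull ℝ (cornerPoints 3) ∧
      (r = 9 - 4 * M ∨ r = 5 - 2 * M ∨ r = 2 - 2 / 3 * M) := by
  have h₀ : ((3 / 2 : ℝ), (3 : ℝ)) ∈ convexHull ℝ (cornerPoints 3) := by
    convert cornerPoint_mem_convexHull (N := 3) (t := 0) (by norm_num) using 1
    norm_num [cornerPoint]
  have h₁ : ((2 : ℝ), (1 : ℝ)) ∈ convexHull ℝ (cornerPoints 3) := by
    convert cornerPoint_mem_convexHull (N := 3) (t := 1) (by norm_num) using 1
    norm_num [cornerPoint]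
  have h₂ : ((9 / 4 : ℝ), (1 / 2 : ℝ)) ∈ convexHull ℝ (cornerPoints 3) := by
    convert cornerPoint_mem_convexHull (N := 3) (t := 2) (by norm_num) using 1
    norm_num [cornerPoint]
  have h₃ : ((3 : ℝ), (0 : ℝ)) ∈ convexHull ℝ (cornerPoints 3) := natCast_zero_mem_convexHull 3
  rcases le_total M 2 with h | h
  · exact ⟨_, mem_of_segment (convex_convexHull ℝ _) h₀ h₁ (by norm_num) ⟨hM.1, h⟩ (by ring),
      Or.inl rfl⟩
  rcases le_total M (9 / 4) with h' | h'
  · exact ⟨_, mem_of_segment (convex_convexHull ℝ _) h₁ h₂ (by norm_num) ⟨h, h'⟩ (by ring),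
      Or.inr (Or.inl rfl)⟩
  · exact ⟨_, mem_of_segment (convex_convexHull ℝ _) h₂ h₃ (by norm_num) ⟨h', hM.2⟩ (by ring),
      Or.inr (Or.inr rfl)⟩

theorem exists_mem_convexHull_le {N : ℕ} (hN : N = 2 ∨ N = 3) {demandLaw : PMF (Demands 2 N)}
    (hfull : ∀ d, demandLaw d ≠ 0) {M : ℝ} (hM : M ∈ Set.Icc ((N : ℝ) / 2) (N : ℝ)) :
    ∃ r, (M, r) ∈ convexHull ℝ (cornerPoints N) ∧
      ∀ R, Achievable (UncodedPlacement 2 N) demandLaw M R → r ≤ R := by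
  rcases hN with rfl | rfl
  · obtain ⟨r, hr, h⟩ := exists_mem_convexHull_two (M := M) (by norm_num at hM ⊢; exact hM)
    refine ⟨r, hr, fun R hR => ?_⟩
    have h₁ := two_mul_sub_le_of_achievable_uncoded hfull hR
    have h₂ := six_mul_sub_le_of_achievable_uncoded le_rfl hfull hR
    push_cast at h₁ h₂
    rcases h with rfl | rfl <;> linarith
  · obtain ⟨r, hr, h⟩ := exists_mem_convexHull_three (M := M) (by norm_num at hM ⊢; exact hM)
    refine ⟨r, hr, fun R hR => ?_⟩
    have h₁ := two_mul_sub_le_of_achievable_uncoded hfull hR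
    have h₂ := six_mul_sub_le_of_achievable_uncoded (by norm_num) hfull hR
    have h₃ := twelve_mul_sub_le_of_achievable_uncoded le_rfl hfull hR
    push_cast at h₁ h₂ h₃
    rcases h with rfl | rfl | rfl <;> linarith

end ConvexHull

end SchemeB

theorem Achievable.mono {K N : ℕ} {𝒮 𝒯 : ∀ B : ℕ, CachingScheme K N B → Prop}
    {demandLaw : PMF (Demands K N)} {M R : ℝ} (h : Achievable 𝒮 demandLaw M R)
    (hle : ∀ B s, 𝒮 B s → 𝒯 B s) : Achievable 𝒯 demandLaw M R := by
  obtain ⟨ε, h0, hlim, hev⟩ := h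
  exact ⟨ε, h0, hlim, hev.mono fun B ⟨s, hs, hv⟩ => ⟨s, hle B s hs, hv⟩⟩

end

theorem corollary1 (N : ℕ) (hN : N = 2 ∨ N = 3)
    (demandLaw : PMF (Demands 2 N)) (hfull : ∀ d : Demands 2 N, demandLaw d ≠ 0)
    (M : ℝ) (hM : M ∈ Set.Icc ((N : ℝ) / 2) (N : ℝ)) :
    IsLeast {R : ℝ | Achievable (SchemeB.IsSchemeB N) demandLaw M R} (SchemeB.load N M) ∧
      IsLeast {R : ℝ | Achievable (UncodedPlacement 2 N) demandLaw M R} (SchemeB.load N M) := by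
  obtain ⟨r, hr, hlow⟩ := SchemeB.exists_mem_convexHull_le hN hfull hM
  have hincl : ∀ R, Achievable (SchemeB.IsSchemeB N) demandLaw M R →
      Achievable (UncodedPlacement 2 N) demandLaw M R :=
    fun R h => h.mono fun B s hs => hs.isUncoded
  have hach : ∀ R, (M, R) ∈ convexHull ℝ (SchemeB.cornerPoints N) →
      Achievable (SchemeB.IsSchemeB N) demandLaw M R :=
    fun R h => (SchemeB.isAttainable_of_mem_convexHull (by omega) h).achievable demandLaw
  have hload : SchemeB.load N M = r :=
    IsLeast.csInf_eq ⟨hr, fun R hR => hlow R (hincl R (hach R hR))⟩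
  rw [hload]
  exact ⟨⟨hach r hr, fun R hR => hlow R (hincl R hR)⟩,
    ⟨hincl r (hach r hr), fun R hR => hlow R hR⟩⟩
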